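/- Proposition 1 (Unity Proposition). Consider a controlled diffusion on $\mathbb{R}^n$, $$\mathrm{d}X_t=\mu(X_t,u_t)\,\mathrm{d}t+\sigma(X_t,u_t)\,\mathrm{d}W_t ,$$ whose coefficients $\mu\in\mathbb{R}^n$ and $\sigma\in\mathbb{R}^{n\times n}$ are continuous on $\mathbb{R}^n\times\overline{U}$, where the set of actions $U\subseteq\mathbb{R}^m$ is a Borel set. Let $Z\subseteq\mathbb{R}^n$ be the closed set of terminal states; a trajectory stays where it is once it reaches $Z$. A controlled process from $x$ consists of a filtered probability space, a bounded $U$-valued progressively measurable action process $u$, and a continuous adapted process $X$ with $X_0=x$ almost surely that is a weak solution of the equation until it reaches $Z$ and stays constant from then on; assume that from every state there is at least one controlled process. Let $B$ be an event whose completion is marked by the terminal states in a Borel set $S_B\subseteq Z$: $B$ occurs at time $s$ if $X_s\in S_B$ and $X_r\notin Z$ for all $r<s$. The grit $\Gamma_B(x)$ is the minimum (infimum), over all controlled processes from $x$, of the probability that $B$ occurs. Then for every state $x$: (1) If $\Gamma_B(x)=1$, then for every controlled process $X$ from $x$, with probability one, $\Gamma_B(X_t)=1$ for all times $t$ up to which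 $B$ has not yet occurred. (2) $\Gamma_B(x)=1$ if and only if, for every controlled process from $x$, that is, whatever the future actions, $B$ occurs with probability one. -/

import Mathlib

open MeasureTheory ProbabilityTheory
open scoped NNReal

/-- A controlled diffusion model on the state space `ℝⁿ` with actions in a subset of `ℝᵐ`.  It
consists of stationary coefficients of `dX = drift (X, u) dt + diffusion (X, u) dW`, which are
continuous in state and action (up to the boundary of the action set), and of the closed set of
terminal states, at which a trajectory ends.  The diffusion matrix may be degenerate; in particular
time may be one of the state components, so that a finite time horizon `T` is the case where the
states whose time component is at least `T` are terminal. -/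
structure DiffusionModel (n m : ℕ) where
  /-- The set of possible actions. -/
  actions : Set (EuclideanSpace ℝ (Fin m))
  /-- The infinitesimal mean. -/
  drift : EuclideanSpace ℝ (Fin n) → EuclideanSpace ℝ (Fin m) → EuclideanSpace ℝ (Fin n)
  /-- The coefficient of the Brownian motion. -/
  diffusion : EuclideanSpace ℝ (Fin n) → EuclideanSpace ℝ (Fin m) → Matrix (Fin n) (Fin n) ℝ
  /-- The terminal states. -/
  terminal : Set (EuclideanSpace ℝ (Fin n))
  measurableSet_actions : MeasurableSet actions
  continuousOn_drift :
    ContinuousOn (Function.uncurry drift) (Set.univ ×ˢ closure actions)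
  continuousOn_diffusion :
    ContinuousOn (Function.uncurry diffusion) (Set.univ ×ˢ closure actions)
  isClosed_terminal : IsClosed terminal

namespace DiffusionModel

variable {n m : ℕ}

/-- The `i`-th partial derivative of a function on `ℝⁿ`. -/
noncomputable def partialDeriv (i : Fin n) (f : EuclideanSpace ℝ (Fin n) → ℝ)
    (y : EuclideanSpace ℝ (Fin n)) : ℝ :=
  fderiv ℝ f y (EuclideanSpace.single i 1)

/-- The generator of the diffusion under the fixed action `a`:
`∑ᵢ μᵢ ∂ᵢ f + (1/2) ∑ᵢⱼ (σ σᵀ)ᵢⱼ ∂ᵢ ∂ⱼ f`. -/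
noncomputable def generator (M : DiffusionModel n m) (a : EuclideanSpace ℝ (Fin m))
    (f : EuclideanSpace ℝ (Fin n) → ℝ) (y : EuclideanSpace ℝ (Fin n)) : ℝ :=
  ∑ i, M.drift y a i * partialDeriv i f y +
    (1 / 2) * ∑ i, ∑ j, (M.diffusion y a * (M.diffusion y a).transpose) i j *
      partialDeriv i (partialDeriv j f) y

open Classical in
/-- The generator of the diffusion which is stopped at the terminal states. -/
noncomputable def stoppedGenerator (M : DiffusionModel n m) (a : EuclideanSpace ℝ (Fin m))
    (f : EuclideanSpace ℝ (Fin n) → ℝ) (y : EuclideanSpace ℝ (Fin n)) : ℝ :=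
  if y ∈ M.terminal then 0 else M.generator a f y

/-- A controlled diffusion started at `x`: on some filtered probability space, a bounded and
non-anticipating course of actions `u` together with a continuous state process `X` which solves
`dX = μ(X, u) dt + σ(X, u) dW`, `X₀ = x`, until it reaches a terminal state, where it stays.  The
equation is understood in the weak sense, that is, as a martingale problem.  The course of actions
`u t = π (X t, t)` that a bounded policy `π` prescribes is a special case. -/
structure ControlledDiffusion (M : DiffusionModel n m) (x : EuclideanSpace ℝ (Fin n)) where
  /-- The sample space. -/
  Ω : Type
  [mΩ : MeasurableSpace Ω]
  /-- The probability. -/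
  P : Measure Ω
  [isProbabilityMeasure : IsProbabilityMeasure P]
  /-- The information available at each time. -/
  ℱ : Filtration ℝ≥0 mΩ
  /-- The state process. -/
  X : ℝ≥0 → Ω → EuclideanSpace ℝ (Fin n)
  /-- The action process. -/
  u : ℝ≥0 → Ω → EuclideanSpace ℝ (Fin m)
  continuous_X : ∀ ω, Continuous fun t => X t ω
  adapted_X : StronglyAdapted ℱ X
  progressive_u : IsStronglyProgressive ℱ u
  u_mem : ∀ t ω, u t ω ∈ M.actions
  u_bounded : ∃ C : ℝ, ∀ t ω, ‖u t ω‖ ≤ C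
  X_zero : ∀ᵐ ω ∂P, X 0 ω = x
  absorbed : ∀ᵐ ω ∂P, ∀ s t, s ≤ t → X s ω ∈ M.terminal → X t ω = X s ω
  martingale : ∀ f : EuclideanSpace ℝ (Fin n) → ℝ, ContDiff ℝ (⊤ : ℕ∞) f → HasCompactSupport f →
    Martingale
      (fun t ω => f (X t ω) -
        ∫ s in (0 : ℝ)..t, M.stoppedGenerator (u s.toNNReal ω) f (X s.toNNReal ω)) ℱ P

attribute [instance] ControlledDiffusion.mΩ ControlledDiffusion.isProbabilityMeasure

/-- The event whose completion is marked by the terminal states in `B` has occurred by time `t`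
along the trajectory `w`: at some time up to `t` the trajectory is in `B`, and it was at no terminal
state before.  (For an event that consists in some state components `j ∈ J` arriving at the values
`b j`, the set `B` is `{y | ∀ j ∈ J, y j = b j}`.) -/
def OccursBy (M : DiffusionModel n m) (B : Set (EuclideanSpace ℝ (Fin n)))
    (w : ℝ≥0 → EuclideanSpace ℝ (Fin n)) (t : ℝ≥0) : Prop :=
  ∃ s ≤ t, w s ∈ B ∧ ∀ r < s, w r ∉ M.terminal

/-- The event occurs along the trajectory `w` at some time. -/
def Occurs (M : DiffusionModel n m) (B : Set (EuclideanSpace ℝ (Fin n)))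
    (w : ℝ≥0 → EuclideanSpace ℝ (Fin n)) : Prop :=
  ∃ t, M.OccursBy B w t

/-- The grit of the event at the state `x`: the minimum (infimum) of the probability that the event
occurs from `x`, over all future courses of actions. -/
noncomputable def grit (M : DiffusionModel n m) (B : Set (EuclideanSpace ℝ (Fin n)))
    (x : EuclideanSpace ℝ (Fin n)) : ℝ :=
  ⨅ S : M.ControlledDiffusion x, S.P.real {ω | M.Occurs B fun t => S.X t ω}

end DiffusionModel

/-! Part (2) holds because an infimum of numbers at most one equals one exactly when all of them do,
the family being nonempty. Part (1) is a dynamic programming argument by contradiction. Suppose that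
a process from a state of grit one visits, with positive outer probability, states outside the
marking set from which some control avoids the event with positive probability. Switching to such a
control on arrival avoids the event with positive probability from the initial state, against (2).

The difficulty is measurability: the new control must depend measurably on the arrival state, and
the arrival time must be a stopping time. Controlled processes are therefore replaced by laws on the
Polish space of joint paths of the state and the time integral of the action. Left differentiation
recovers the action at almost every time, so the law carries the control as well. Laws are coded by
points of a Polish space (`exists_kernel_attaining_probabilityMeasures`), and being the code of a
solution is a Borel condition (`measurableSet_isSolution`), because the martingale problem reduces
to countably many integrals. Hence the avoidable states form an analytic set.

Capacitability (`exists_box_hitBy_ne_zero`) replaces this set by a compact subset that is still hit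
with positive probability. Over the compact set a Borel choice of codes exists
(`exists_measurable_section`), and its first hitting time is a stopping time. Optional stopping then
shows that the pasted law solves the martingale problem (`IsSolution.map_switchPath`). -/

open Filter Topology

/-! ### Continuous paths: stopping, concatenation and the canonical filtration. -/

section PathSpace

variable {F : Type*} [NormedAddCommGroup F]

/-- The space of continuous paths carries its Borel `σ`-algebra. -/
instance ContinuousMap.measurableSpacePath : MeasurableSpace C(ℝ≥0, F) := borel _

instance ContinuousMap.borelSpacePath : BorelSpace C(ℝ≥0, F) := ⟨rfl⟩

/-- The path `w` stopped at the time `t`. -/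
def stopPath (t : ℝ≥0) (w : C(ℝ≥0, F)) : C(ℝ≥0, F) :=
  w.comp ⟨fun r => min r t, by fun_prop⟩

@[simp]
theorem stopPath_apply (t r : ℝ≥0) (w : C(ℝ≥0, F)) : stopPath t w r = w (min r t) := rfl

theorem stopPath_stopPath (s t : ℝ≥0) (w : C(ℝ≥0, F)) :
    stopPath s (stopPath t w) = stopPath (min s t) w := by
  ext r
  simp [min_assoc]

theorem continuous_stopPath (t : ℝ≥0) : Continuous (stopPath t : C(ℝ≥0, F) → C(ℝ≥0, F)) :=
  ContinuousMap.continuous_precomp _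

theorem measurable_stopPath (t : ℝ≥0) : Measurable (stopPath t : C(ℝ≥0, F) → C(ℝ≥0, F)) :=
  (continuous_stopPath t).measurable

variable (F) in
/-- The filtration generated by the coordinate process on the space of continuous paths. -/
def pathFiltration : Filtration ℝ≥0 (inferInstance : MeasurableSpace C(ℝ≥0, F)) where
  seq t := MeasurableSpace.comap (stopPath t) inferInstance
  mono' s t hst := by
    rintro _ ⟨G, hG, rfl⟩
    refine ⟨stopPath s ⁻¹' G, measurable_stopPath s hG, ?_⟩
    rw [← Set.preimage_comp]
    congr 1
    ext1 w
    simp [stopPath_stopPath, min_eq_left hst]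
  le' t := (measurable_stopPath t).comap_le

theorem measurable_stopPath_pathFiltration (t : ℝ≥0) :
    Measurable[pathFiltration F t] (stopPath t : C(ℝ≥0, F) → C(ℝ≥0, F)) :=
  comap_measurable _

/-- A measurable function of the path that does not depend on the path after time `t` is measurable
with respect to the information at time `t`. -/
theorem measurable_pathFiltration {β : Type*} [MeasurableSpace β] {t : ℝ≥0} {g : C(ℝ≥0, F) → β}
    (hg : Measurable g) (h : ∀ w, g (stopPath t w) = g w) : Measurable[pathFiltration F t] g := by
  have : g = g ∘ stopPath t := funext fun w => (h w).symm
  rw [this]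
  exact hg.comp (measurable_stopPath_pathFiltration t)

/-- Since stopping at `t` is idempotent, the preimages of Borel sets under `stopPath t` are exactly
the Borel sets invariant under it (Galmarino's test). -/
theorem measurableSet_pathFiltration_iff {t : ℝ≥0} {G : Set C(ℝ≥0, F)} :
    MeasurableSet[pathFiltration F t] G ↔
      MeasurableSet G ∧ ∀ w, stopPath t w ∈ G ↔ w ∈ G := by
  constructor
  · intro h
    refine ⟨(pathFiltration F).le t _ h, ?_⟩
    obtain ⟨G', -, rfl⟩ := h
    intro w
    simp [stopPath_stopPath]
  · rintro ⟨hG, h⟩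
    exact ⟨G, hG, Set.ext h⟩

/-- The path that follows `w` until time `r` and the increments of `v` afterwards. -/
def concatPath (r : ℝ≥0) (w v : C(ℝ≥0, F)) : C(ℝ≥0, F) :=
  ⟨fun t => w (min t r) + (v (t - r) - v 0), by fun_prop⟩

variable [MeasurableSpace F] [BorelSpace F]

theorem measurable_evalPath (t : ℝ≥0) : Measurable fun w : C(ℝ≥0, F) => w t :=
  (continuous_eval_const t).measurable

theorem measurable_uncurry_evalPath : Measurable fun p : C(ℝ≥0, F) × ℝ≥0 => p.1 p.2 :=
  continuous_eval.measurable

theorem Measurable.evalPath {α : Type*} [MeasurableSpace α] {h : α → C(ℝ≥0, F)} {τ : α → ℝ≥0}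
    (hh : Measurable h) (hτ : Measurable τ) : Measurable fun a => h a (τ a) :=
  measurable_uncurry_evalPath.comp (hh.prodMk hτ)

variable [CompleteSpace F] [SecondCountableTopology F]

instance ContinuousMap.polishSpacePath : PolishSpace C(ℝ≥0, F) where
  toIsCompletelyMetrizableSpace := inferInstance

/-- A continuous injection between Polish spaces is a measurable embedding (Lusin–Souslin), and a
continuous path is determined by its values on a dense set. Hence the coordinates generate the Borel
`σ`-algebra of the path space. -/
theorem measurableEmbedding_evalPath_denseSeq :
    MeasurableEmbedding fun (w : C(ℝ≥0, F)) (k : ℕ) => w (TopologicalSpace.denseSeq ℝ≥0 k) := by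
  refine Continuous.measurableEmbedding
    (continuous_pi fun k => continuous_eval_const _) fun w v h => ?_
  refine ContinuousMap.ext fun t => congrFun (?_ : (w : ℝ≥0 → F) = v) t
  refine (TopologicalSpace.denseRange_denseSeq ℝ≥0).equalizer w.continuous v.continuous ?_
  exact h

/-- A function with values in the space of continuous paths is measurable if the value of the path
at each time is measurable. -/
theorem measurable_path_of_eval {α : Type*} [MeasurableSpace α] {h : α → C(ℝ≥0, F)}
    (hh : ∀ t, Measurable fun a => h a t) : Measurable h := by
  rw [← measurableEmbedding_evalPath_denseSeq.measurable_comp_iff]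
  exact measurable_pi_lambda _ fun k => hh _

end PathSpace

/-! ### Coding of probability measures; countable generation. -/

section Coding

/-- A kernel from a Polish space of codes which attains every probability measure on a given
standard Borel space. -/
theorem exists_kernel_attaining_probabilityMeasures (α : Type*) [MeasurableSpace α]
    [StandardBorelSpace α] [Nonempty α] :
    ∃ κ : Kernel (ℚ → ℝ) α, IsMarkovKernel κ ∧
      ∀ μ : Measure α, IsProbabilityMeasure μ → ∃ c, κ c = μ := by
  have hid : Measurable (id : (ℚ → ℝ) → ℚ → ℝ) := measurable_id
  let κ₀ : Kernel (ℚ → ℝ) ℝ :=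
    ⟨fun c => (stieltjesOfMeasurableRat id hid c).measure,
      measurable_measure_stieltjesOfMeasurableRat hid⟩
  have h₀ : IsMarkovKernel κ₀ :=
    ⟨fun c => instIsProbabilityMeasure_stieltjesOfMeasurableRat hid c⟩
  have he := measurableEmbedding_embeddingReal α
  refine ⟨κ₀.map he.invFun, Kernel.IsMarkovKernel.map _ he.measurable_invFun, fun μ hμ => ?_⟩
  set ρ := μ.map (embeddingReal α) with hρ
  have : IsProbabilityMeasure ρ := Measure.isProbabilityMeasure_map he.measurable.aemeasurable
  -- The code of `μ` is the distribution function, at rational points, of its image in `ℝ`; right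
  -- continuity recovers the whole function from these values.
  refine ⟨fun q => cdf ρ q, ?_⟩
  have hpt : IsRatStieltjesPoint (id : (ℚ → ℝ) → ℚ → ℝ) fun q => cdf ρ q := by
    refine ⟨fun a b hab => monotone_cdf ρ (by exact_mod_cast hab),
      (tendsto_cdf_atTop ρ).comp (tendsto_ratCast_atTop_iff.2 tendsto_id),
      (tendsto_cdf_atBot ρ).comp (tendsto_ratCast_atBot_iff.2 tendsto_id), fun t => ?_⟩
    rw [id, ← (cdf ρ).iInf_rat_gt_eq t]
    exact (Equiv.subtypeEquivRight fun r => by simp).iInf_congr fun r => rfl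
  have hκ₀ : κ₀ (fun q => cdf ρ q) = ρ := by
    refine Eq.trans ?_ (measure_cdf ρ)
    change (stieltjesOfMeasurableRat id hid _).measure = _
    congr 1
    refine StieltjesFunction.ext fun x => ?_
    rw [← StieltjesFunction.iInf_rat_gt_eq, ← StieltjesFunction.iInf_rat_gt_eq]
    congr 1
    funext r
    rw [stieltjesOfMeasurableRat_eq, toRatCDF_of_isRatStieltjesPoint hpt]
    rfl
  rw [Kernel.map_apply _ he.measurable_invFun, hκ₀, hρ,
    Measure.map_map he.measurable_invFun he.measurable]
  have : he.invFun ∘ embeddingReal α = id := funext he.leftInverse_invFun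
  rw [this, Measure.map_id]

/-- A countably generated `σ`-algebra is generated by a countable `π`-system. -/
theorem exists_countable_isPiSystem_generateFrom (α : Type*) [m : MeasurableSpace α]
    [MeasurableSpace.CountablyGenerated α] :
    ∃ S : Set (Set α), S.Countable ∧ IsPiSystem S ∧ Set.univ ∈ S ∧
      m = MeasurableSpace.generateFrom S := by
  obtain ⟨b, hb, hm⟩ := MeasurableSpace.CountablyGenerated.isCountablyGenerated (α := α)
  refine ⟨Set.sInter '' {t | t.Finite ∧ t ⊆ b}, (Set.countable_ofPred_finite_subset hb).image _,
    ?_, ⟨∅, ⟨Set.finite_empty, Set.empty_subset _⟩, Set.sInter_empty⟩, le_antisymm ?_ ?_⟩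
  · rintro _ ⟨s, ⟨hs, hsb⟩, rfl⟩ _ ⟨t, ⟨ht, htb⟩, rfl⟩ -
    exact ⟨s ∪ t, ⟨hs.union ht, Set.union_subset hsb htb⟩, Set.sInter_union s t⟩
  · rw [hm]
    refine MeasurableSpace.generateFrom_mono fun s hs => ⟨{s}, ⟨Set.finite_singleton s, ?_⟩, ?_⟩
    · simpa using hs
    · simp
  · refine MeasurableSpace.generateFrom_le ?_
    rintro _ ⟨s, ⟨hs, hsb⟩, rfl⟩
    refine MeasurableSet.sInter hs.countable fun t ht => ?_
    rw [hm]
    exact MeasurableSpace.measurableSet_generateFrom (hsb ht)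

end Coding

/-! ### Paths that hit a set. -/

section Hitting

variable {F : Type*} [NormedAddCommGroup F]

/-- The paths which visit the set `K` up to time `t`. -/
def hitBy (K : Set F) (t : ℝ≥0) : Set C(ℝ≥0, F) := {w | ∃ s ≤ t, w s ∈ K}

theorem hitBy_mono {K K' : Set F} (h : K ⊆ K') (t : ℝ≥0) : hitBy K t ⊆ hitBy K' t :=
  fun _ ⟨s, hs, hw⟩ => ⟨s, hs, h hw⟩

theorem stopPath_mem_hitBy_iff {K : Set F} {t : ℝ≥0} {w : C(ℝ≥0, F)} :
    stopPath t w ∈ hitBy K t ↔ w ∈ hitBy K t := by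
  refine exists_congr fun s => and_congr_right fun hs => ?_
  rw [stopPath_apply, min_eq_left hs]

/-- A path which comes arbitrarily close to a closed set up to time `t` hits it. -/
theorem mem_hitBy_of_forall_infEDist {K : Set F} (hK : IsClosed K) {t : ℝ≥0} {w : C(ℝ≥0, F)}
    (h : ∀ j : ℕ, ∃ s ≤ t, Metric.infEDist (w s) K ≤ ((j : ENNReal) + 1)⁻¹) : w ∈ hitBy K t := by
  have hc : Continuous fun s => Metric.infEDist (w s) K :=
    Metric.continuous_infEDist.comp w.continuous
  obtain ⟨s, hs, hmin⟩ := (isCompact_Icc (a := (0 : ℝ≥0)) (b := t)).exists_isMinOn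
    ⟨0, by simp⟩ hc.continuousOn
  refine ⟨s, hs.2, (Metric.mem_iff_infEDist_zero_of_closed hK).2 ?_⟩
  by_contra h0
  obtain ⟨j, hj⟩ := ENNReal.exists_inv_nat_lt h0
  obtain ⟨r, hr, hrj⟩ := h j
  have h1 : Metric.infEDist (w s) K ≤ Metric.infEDist (w r) K := hmin ⟨zero_le, hr⟩
  have h2 : ((j : ENNReal) + 1)⁻¹ ≤ (j : ENNReal)⁻¹ := ENNReal.inv_le_inv.2 le_self_add
  exact absurd (h1.trans (hrj.trans h2)) (not_le.2 hj)

variable [MeasurableSpace F] [BorelSpace F]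

/-- For closed `K` countably many times suffice: the path hits `K` by time `t` exactly when the
stopped path comes closer to `K` than each `1 / (j + 1)` at some time of a dense sequence. -/
theorem measurableSet_hitBy_pathFiltration {K : Set F} (hK : IsClosed K) (t : ℝ≥0) :
    MeasurableSet[pathFiltration F t] (hitBy K t) := by
  refine measurableSet_pathFiltration_iff.2 ⟨?_, fun w => stopPath_mem_hitBy_iff⟩
  have : hitBy K t = ⋂ j : ℕ, ⋃ k : ℕ, {w | Metric.infEDist
      (stopPath t w (TopologicalSpace.denseSeq ℝ≥0 k)) K < ((j : ENNReal) + 1)⁻¹} := by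
    ext w
    simp only [Set.mem_iInter, Set.mem_iUnion, Set.mem_ofPred_eq]
    constructor
    · rintro ⟨s, hs, hw⟩ j
      have hc : Continuous fun s => Metric.infEDist (stopPath t w s) K :=
        Metric.continuous_infEDist.comp (stopPath t w).continuous
      exact (TopologicalSpace.denseRange_denseSeq ℝ≥0).exists_mem_open
        (isOpen_lt hc (continuous_const (y := ((j : ENNReal) + 1)⁻¹))) ⟨s, by
          rw [Set.mem_ofPred_eq, stopPath_apply, min_eq_left hs, Metric.infEDist_zero_of_mem hw]
          simp⟩
    · intro h
      refine mem_hitBy_of_forall_infEDist hK fun j => ?_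
      obtain ⟨k, hk⟩ := h j
      exact ⟨_, min_le_right _ _, hk.le⟩
  rw [this]
  refine MeasurableSet.iInter fun j => MeasurableSet.iUnion fun k => ?_
  refine measurableSet_lt ?_ measurable_const
  exact (Metric.continuous_infEDist.measurable.comp (measurable_evalPath _)).comp
    (measurable_stopPath t)

theorem measurableSet_hitBy {K : Set F} (hK : IsClosed K) (t : ℝ≥0) : MeasurableSet (hitBy K t) :=
  (pathFiltration F).le t _ (measurableSet_hitBy_pathFiltration hK t)

end Hitting

/-! ### Capacitability of hitting probabilities. -/

section Capacity

theorem isCompact_box (a : ℕ → ℕ) : IsCompact {z : ℕ → ℕ | ∀ i, z i ≤ a i} := by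
  have := isCompact_univ_pi fun i => (Set.finite_Iic (a i)).isCompact
  simpa [Set.pi] using this

/-- A neighbourhood of a compact box in `ℕ → ℕ` contains a cylinder over finitely many sides of
the box. -/
theorem exists_cylinder_subset_of_box_subset {a : ℕ → ℕ} {O : Set (ℕ → ℕ)} (hO : IsOpen O)
    (h : {z : ℕ → ℕ | ∀ i, z i ≤ a i} ⊆ O) : ∃ k, {z : ℕ → ℕ | ∀ i < k, z i ≤ a i} ⊆ O := by
  by_contra hcon
  simp only [not_exists, Set.not_subset] at hcon
  choose z hz hzO using hcon
  have hL := isCompact_box a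
  -- Truncation moves `z k` into the compact box without changing the coordinates below `k`, so a
  -- limit of truncations is also a limit of the points themselves.
  obtain ⟨y, hy, φ, hφ, hlim⟩ := hL.tendsto_subseq (x := fun k i => min (z k i) (a i))
    fun k i => min_le_right _ _
  have hlim' : Tendsto (fun j => z (φ j)) atTop (𝓝 y) := by
    rw [tendsto_pi_nhds] at hlim ⊢
    intro i
    refine (hlim i).congr' ?_
    filter_upwards [eventually_gt_atTop i] with j hj
    exact min_eq_left (hz (φ j) i (hj.trans_le hφ.le_apply))
  obtain ⟨j, hj⟩ := (hlim'.eventually_mem (hO.mem_nhds (h hy))).exists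
  exact hzO _ hj

/-- A set function which is monotone and continuous along increasing sequences is almost attained
on cylinders with bounded sides. -/
theorem exists_bounds_of_lt {c : Set (ℕ → ℕ) → ENNReal}
    (hc : ∀ S : ℕ → Set (ℕ → ℕ), Monotone S → c (⋃ b, S b) = ⨆ b, c (S b)) {ε : ENNReal}
    (hε : ε < c Set.univ) : ∃ a : ℕ → ℕ, ∀ k, ε < c {z | ∀ i < k, z i ≤ a i} := by
  have step : ∀ (k : ℕ) (S : Set (ℕ → ℕ)), ε < c S → ∃ b, ε < c (S ∩ {z | z k ≤ b}) := by
    intro k S hS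
    have : S = ⋃ b, S ∩ {z | z k ≤ b} := by
      ext z
      simpa using fun _ => ⟨z k, le_rfl⟩
    rw [this, hc (fun b => S ∩ {z | z k ≤ b}) fun b b' hb =>
      Set.inter_subset_inter_right _ fun z hz => le_trans hz hb] at hS
    exact lt_iSup_iff.1 hS
  choose! b hb using step
  let S : ℕ → Set (ℕ → ℕ) := fun k => Nat.rec Set.univ (fun k S => S ∩ {z | z k ≤ b k S}) k
  have hS : ∀ k, ε < c (S k) := by
    intro k
    induction k with
    | zero => exact hε
    | succ k ih => exact hb k _ ih
  refine ⟨fun k => b k (S k), fun k => ?_⟩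
  have : {z : ℕ → ℕ | ∀ i < k, z i ≤ b i (S i)} = S k := by
    induction k with
    | zero => simp [S]
    | succ k ih =>
      change _ = S k ∩ {z | z k ≤ b k (S k)}
      ext z
      rw [Set.mem_inter_iff, ← Set.ext_iff.1 ih z]
      simp only [Set.mem_ofPred_eq, Nat.lt_succ_iff_lt_or_eq, or_imp, forall_and, forall_eq]
  rw [this]
  exact hS k

variable {E A : Type*} [NormedAddCommGroup E] [NormedAddCommGroup A] [MeasurableSpace E]
  [BorelSpace E] [MeasurableSpace A] [BorelSpace A] [SecondCountableTopology E]

/-- Capacitability: if the first component of a continuous process hits an analytic set with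
positive outer probability, then it hits a compact subset with positive probability. -/
theorem exists_box_hitBy_ne_zero (Q : Measure C(ℝ≥0, E × A)) [IsFiniteMeasure Q]
    {g : (ℕ → ℕ) → E} (hg : Continuous g) (t : ℝ≥0)
    (h : Q (hitBy (Prod.fst ⁻¹' Set.range g) t) ≠ 0) :
    ∃ a : ℕ → ℕ, Q (hitBy (Prod.fst ⁻¹' (g '' {z | ∀ i, z i ≤ a i})) t) ≠ 0 := by
  obtain ⟨ε, hε0, hε⟩ := exists_between (pos_iff_ne_zero.2 h)
  obtain ⟨a, ha⟩ := exists_bounds_of_lt (c := fun S => Q (hitBy (Prod.fst ⁻¹' (g '' S)) t))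
    (fun S hS => by
      -- Continuity from below holds for increasing sequences of arbitrary sets. This matters
      -- because the paths hitting `g '' S b` need not form a measurable set.
      rw [← Monotone.measure_iUnion fun i j hij =>
        hitBy_mono (Set.preimage_mono (Set.image_mono (hS hij))) t]
      congr 1
      ext w
      simp only [hitBy, Set.image_iUnion, Set.preimage_iUnion, Set.mem_iUnion, Set.mem_ofPred_eq]
      exact ⟨fun ⟨s, hs, i, hi⟩ => ⟨i, s, hs, hi⟩, fun ⟨i, s, hs, hi⟩ => ⟨s, hs, i, hi⟩⟩)
    (by rwa [Set.image_univ])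
  refine ⟨a, (hε0.trans_le ?_).ne'⟩
  set L : Set (ℕ → ℕ) := {z | ∀ i, z i ≤ a i}
  have hL : IsCompact L := isCompact_box a
  have hK : IsClosed (g '' L) := (hL.image hg).isClosed
  -- These closed neighbourhoods shrink to the compact image. Their hitting sets are measurable, so
  -- continuity from above applies; each neighbourhood contains the image of a cylinder, so its
  -- hitting set has measure above `ε`.
  let C : ℕ → Set E := fun j => {y | Metric.infEDist y (g '' L) ≤ ((j : ENNReal) + 1)⁻¹}
  have hC : ∀ j, IsClosed (C j) := fun j =>
    isClosed_le Metric.continuous_infEDist continuous_const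
  have hanti : Antitone fun j => hitBy (Prod.fst ⁻¹' C j : Set (E × A)) t := fun i j hij =>
    hitBy_mono (Set.preimage_mono fun y hy => le_trans hy
      (ENNReal.inv_le_inv.2 (by gcongr))) t
  have hsub : ⋂ j, hitBy (Prod.fst ⁻¹' C j : Set (E × A)) t ⊆
      hitBy (Prod.fst ⁻¹' (g '' L)) t := by
    intro w hw
    have := mem_hitBy_of_forall_infEDist hK (t := t)
      (w := ContinuousMap.comp ⟨Prod.fst, continuous_fst⟩ w) fun j => Set.mem_iInter.1 hw j
    exact this
  refine le_trans ?_ (measure_mono hsub)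
  rw [hanti.measure_iInter (fun j => (measurableSet_hitBy
    ((hC j).preimage continuous_fst) t).nullMeasurableSet) ⟨0, measure_ne_top _ _⟩]
  refine le_iInf fun j => ?_
  have hO : IsOpen {z | Metric.infEDist (g z) (g '' L) < ((j : ENNReal) + 1)⁻¹} :=
    isOpen_lt (Metric.continuous_infEDist.comp hg) continuous_const
  obtain ⟨k, hk⟩ := exists_cylinder_subset_of_box_subset (a := a) hO fun z hz => by
    rw [Set.mem_ofPred_eq, Metric.infEDist_zero_of_mem (Set.mem_image_of_mem g hz)]
    simp
  refine (ha k).le.trans (measure_mono (hitBy_mono (Set.preimage_mono ?_) t))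
  rintro _ ⟨z, hz, rfl⟩
  exact le_of_lt (Set.mem_ofPred_eq ▸ hk hz)

end Capacity

/-! ### Measurable selection over a compact set. -/

section Selection

variable {E : Type*} [TopologicalSpace E] [T2Space E] [MeasurableSpace E] [BorelSpace E]

/-- A continuous map on a compact subset of `ℕ → ℕ` has a measurable section. -/
theorem exists_measurable_section {L : Set (ℕ → ℕ)} (hL : IsCompact L) {g : (ℕ → ℕ) → E}
    (hg : Continuous g) :
    ∃ σ : E → ℕ → ℕ, Measurable σ ∧ ∀ y ∈ g '' L, σ y ∈ L ∧ g (σ y) = y := by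
  -- `R k y` keeps the points of the fibre over `y` in `L` whose first `k` coordinates are
  -- successively minimal, so for a nonempty fibre `σ y` is its lexicographically least point.
  let R : ℕ → E → Set (ℕ → ℕ) := fun k =>
    Nat.rec (fun y => L ∩ g ⁻¹' {y}) (fun k R y => R y ∩ {z | z k = sInf ((· k) '' R y)}) k
  let σ : E → ℕ → ℕ := fun y k => sInf ((· k) '' R k y)
  have hR : ∀ k y, R (k + 1) y = R k y ∩ {z | z k = σ y k} := fun k y => rfl
  have hcl : ∀ k j, IsClosed {z : ℕ → ℕ | z k = j} := fun k j =>
    isClosed_eq (continuous_apply k) continuous_const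
  have hσ_of : ∀ k, (∀ C : Set (ℕ → ℕ), IsClosed C → MeasurableSet {y | (R k y ∩ C).Nonempty}) →
      ∀ j, MeasurableSet {y | σ y k = j} := by
    intro k hk j
    have hA : ∀ i, MeasurableSet {y | (R k y ∩ {z | z k = i}).Nonempty} := fun i => hk _ (hcl k i)
    have hAi : ∀ i y, (R k y ∩ {z | z k = i}).Nonempty ↔ i ∈ (· k) '' R k y := fun i y =>
      ⟨fun ⟨z, hz, hzi⟩ => ⟨z, hz, hzi⟩, fun ⟨z, hz, hzi⟩ => ⟨z, hz, hzi⟩⟩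
    -- The second alternative covers empty fibres, where `sInf ∅ = 0`.
    have : {y | σ y k = j} = ({y | (R k y ∩ {z | z k = j}).Nonempty} ∩
          ⋂ i, ⋂ (_ : i < j), {y | (R k y ∩ {z | z k = i}).Nonempty}ᶜ) ∪
        ({_y | j = 0} ∩ ⋂ i, {y | (R k y ∩ {z | z k = i}).Nonempty}ᶜ) := by
      ext y
      simp only [hAi, Set.mem_union, Set.mem_inter_iff, Set.mem_iInter, Set.mem_compl_iff,
        Set.mem_ofPred_eq]
      change sInf _ = j ↔ _
      constructor
      · rintro rfl
        by_cases hne : ((· k) '' R k y).Nonempty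
        · exact Or.inl ⟨Nat.sInf_mem hne, fun i hi => Nat.notMem_of_lt_sInf hi⟩
        · rw [Set.not_nonempty_iff_eq_empty.1 hne]
          simp
      · rintro (⟨h1, h2⟩ | ⟨rfl, h⟩)
        · refine le_antisymm (Nat.sInf_le h1) ?_
          by_contra hlt
          exact h2 _ (not_le.1 hlt) (Nat.sInf_mem ⟨j, h1⟩)
        · rw [Set.eq_empty_of_forall_notMem h, Nat.sInf_empty]
    rw [this]
    exact ((hA j).inter (.iInter fun i => .iInter fun _ => (hA i).compl)).union
      ((MeasurableSet.const _).inter (.iInter fun i => (hA i).compl))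
  have hmeas : ∀ k (C : Set (ℕ → ℕ)), IsClosed C → MeasurableSet {y | (R k y ∩ C).Nonempty} := by
    intro k
    induction k with
    | zero =>
      intro C hC
      have : {y | (R 0 y ∩ C).Nonempty} = g '' (L ∩ C) := by
        ext y
        constructor
        · rintro ⟨z, ⟨hz, hzy⟩, hzC⟩
          exact ⟨z, ⟨hz, hzC⟩, hzy⟩
        · rintro ⟨z, ⟨hz, hzC⟩, hzy⟩
          exact ⟨z, ⟨hz, hzy⟩, hzC⟩
      rw [this]
      exact ((hL.inter_right hC).image hg).isClosed.measurableSet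
    | succ k ih =>
      intro C hC
      have : {y | (R (k + 1) y ∩ C).Nonempty} =
          ⋃ j, {y | σ y k = j} ∩ {y | (R k y ∩ ({z | z k = j} ∩ C)).Nonempty} := by
        ext y
        simp [hR, Set.inter_assoc]
      rw [this]
      exact .iUnion fun j => (hσ_of k ih j).inter (ih _ ((hcl k j).inter hC))
  refine ⟨σ, measurable_pi_lambda _ fun k => measurable_to_countable' fun j =>
    hσ_of k (hmeas k) j, fun y hy => ?_⟩
  have hne : ∀ k, (R k y).Nonempty := by
    intro k
    induction k with
    | zero =>
      obtain ⟨z, hz, hzy⟩ := hy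
      exact ⟨z, hz, hzy⟩
    | succ k ih =>
      obtain ⟨z, hz, hzk⟩ := Nat.sInf_mem (ih.image (· k))
      exact ⟨z, hz, hzk⟩
  have hclosed : ∀ k, IsCompact (R k y) := by
    intro k
    induction k with
    | zero => exact hL.inter_right (isClosed_singleton.preimage hg)
    | succ k ih => exact ih.inter_right (hcl k _)
  obtain ⟨z, hz⟩ := IsCompact.nonempty_iInter_of_sequence_nonempty_isCompact_isClosed
    (fun k => R k y) (fun k => Set.inter_subset_left) hne (hclosed 0) fun k => (hclosed k).isClosed
  rw [Set.mem_iInter] at hz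
  have : σ y = z := funext fun k => ((hz (k + 1)).2 : z k = σ y k).symm
  rw [this]
  exact hz 0

end Selection

/-! ### Test functions, generators and a countable dense family. -/

namespace DiffusionModel

variable {n m : ℕ}

/-- The value and the first and second partial derivatives of a function. -/
noncomputable def jet (f : EuclideanSpace ℝ (Fin n) → ℝ) (y : EuclideanSpace ℝ (Fin n)) :
    ℝ × (Fin n → ℝ) × (Fin n → Fin n → ℝ) :=
  (f y, fun i => partialDeriv i f y, fun i j => partialDeriv i (partialDeriv j f) y)

theorem contDiff_partialDeriv {f : EuclideanSpace ℝ (Fin n) → ℝ} (hf : ContDiff ℝ (⊤ : ℕ∞) f)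
    (i : Fin n) : ContDiff ℝ (⊤ : ℕ∞) (partialDeriv i f) :=
  (hf.fderiv_right (m := ((⊤ : ℕ∞) : WithTop ℕ∞)) (by simp)).clm_apply contDiff_const

theorem continuous_jet {f : EuclideanSpace ℝ (Fin n) → ℝ} (hf : ContDiff ℝ (⊤ : ℕ∞) f) :
    Continuous (jet f) :=
  hf.continuous.prodMk ((continuous_pi fun i => (contDiff_partialDeriv hf i).continuous).prodMk
    (continuous_pi fun i => continuous_pi fun j =>
      (contDiff_partialDeriv (contDiff_partialDeriv hf j) i).continuous))

theorem support_partialDeriv_subset (f : EuclideanSpace ℝ (Fin n) → ℝ) (i : Fin n) :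
    Function.support (partialDeriv i f) ⊆ tsupport f := by
  intro y hy
  by_contra hy'
  refine hy ?_
  have : fderiv ℝ f y = 0 := by
    by_contra h
    exact hy' (support_fderiv_subset ℝ h)
  simp [partialDeriv, this]

theorem jet_eq_zero_of_notMem {f : EuclideanSpace ℝ (Fin n) → ℝ} {y : EuclideanSpace ℝ (Fin n)}
    (hy : y ∉ tsupport f) : jet f y = 0 := by
  have h1 : f y = 0 := image_eq_zero_of_notMem_tsupport hy
  have h2 : ∀ i, partialDeriv i f y = 0 := fun i => by
    by_contra h
    exact hy (support_partialDeriv_subset f i h)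
  have h3 : ∀ i j, partialDeriv i (partialDeriv j f) y = 0 := fun i j => by
    by_contra h
    exact hy (closure_minimal (support_partialDeriv_subset f j) (isClosed_tsupport f)
      (support_partialDeriv_subset _ i h))
  simp only [jet, h1, h2, h3]
  rfl

variable (M : DiffusionModel n m)

/-- The generator as a linear function of the derivatives. -/
noncomputable def jetGenerator (a : EuclideanSpace ℝ (Fin m)) (y : EuclideanSpace ℝ (Fin n))
    (p : ℝ × (Fin n → ℝ) × (Fin n → Fin n → ℝ)) : ℝ :=
  ∑ i, M.drift y a i * p.2.1 i +
    (1 / 2) * ∑ i, ∑ j, (M.diffusion y a * (M.diffusion y a).transpose) i j * p.2.2 i j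

theorem generator_eq_jetGenerator (a : EuclideanSpace ℝ (Fin m))
    (f : EuclideanSpace ℝ (Fin n) → ℝ) (y : EuclideanSpace ℝ (Fin n)) :
    M.generator a f y = M.jetGenerator a y (jet f y) := rfl

theorem jetGenerator_sub (a : EuclideanSpace ℝ (Fin m)) (y : EuclideanSpace ℝ (Fin n))
    (p q : ℝ × (Fin n → ℝ) × (Fin n → Fin n → ℝ)) :
    M.jetGenerator a y (p - q) = M.jetGenerator a y p - M.jetGenerator a y q := by
  simp only [jetGenerator, Prod.snd_sub, Prod.fst_sub, Pi.sub_apply, mul_sub,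
    Finset.sum_sub_distrib]
  ring

theorem jetGenerator_zero (a : EuclideanSpace ℝ (Fin m)) (y : EuclideanSpace ℝ (Fin n)) :
    M.jetGenerator a y 0 = 0 := by
  simp [jetGenerator]

/-- The sum of the absolute values of the coefficients of the generator. -/
noncomputable def coeffSize (y : EuclideanSpace ℝ (Fin n)) (a : EuclideanSpace ℝ (Fin m)) : ℝ :=
  ∑ i, |M.drift y a i| +
    (1 / 2) * ∑ i, ∑ j, |(M.diffusion y a * (M.diffusion y a).transpose) i j|

theorem abs_jetGenerator_le (a : EuclideanSpace ℝ (Fin m)) (y : EuclideanSpace ℝ (Fin n))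
    (p : ℝ × (Fin n → ℝ) × (Fin n → Fin n → ℝ)) :
    |M.jetGenerator a y p| ≤ M.coeffSize y a * ‖p‖ := by
  have hp1 : ∀ i, |p.2.1 i| ≤ ‖p‖ := fun i =>
    (norm_le_pi_norm p.2.1 i).trans ((norm_fst_le p.2).trans (norm_snd_le p))
  have hp2 : ∀ i j, |p.2.2 i j| ≤ ‖p‖ := fun i j =>
    ((norm_le_pi_norm (p.2.2 i) j).trans (norm_le_pi_norm p.2.2 i)).trans
      ((norm_snd_le p.2).trans (norm_snd_le p))
  rw [jetGenerator, coeffSize, add_mul, mul_assoc, Finset.sum_mul]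
  simp only [Finset.sum_mul]
  refine (abs_add_le _ _).trans (add_le_add ?_ ?_)
  · refine (Finset.abs_sum_le_sum_abs _ _).trans (Finset.sum_le_sum fun i _ => ?_)
    rw [abs_mul]
    exact mul_le_mul_of_nonneg_left (hp1 i) (abs_nonneg _)
  · rw [abs_mul, abs_of_pos (by norm_num : (0 : ℝ) < 1 / 2)]
    refine mul_le_mul_of_nonneg_left ?_ (by norm_num)
    refine (Finset.abs_sum_le_sum_abs _ _).trans (Finset.sum_le_sum fun i _ => ?_)
    refine (Finset.abs_sum_le_sum_abs _ _).trans (Finset.sum_le_sum fun j _ => ?_)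
    rw [abs_mul]
    exact mul_le_mul_of_nonneg_left (hp2 i j) (abs_nonneg _)

theorem continuousOn_drift_apply (i : Fin n) :
    ContinuousOn (fun p : EuclideanSpace ℝ (Fin n) × EuclideanSpace ℝ (Fin m) => M.drift p.1 p.2 i)
      (Set.univ ×ˢ closure M.actions) :=
  (EuclideanSpace.proj (𝕜 := ℝ) i).continuous.comp_continuousOn M.continuousOn_drift

theorem continuousOn_diffusion_apply (i j : Fin n) :
    ContinuousOn (fun p : EuclideanSpace ℝ (Fin n) × EuclideanSpace ℝ (Fin m) =>
      (M.diffusion p.1 p.2 * (M.diffusion p.1 p.2).transpose) i j)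
      (Set.univ ×ˢ closure M.actions) := by
  have h : Continuous fun σ : Matrix (Fin n) (Fin n) ℝ => (σ * σ.transpose) i j :=
    (continuous_id.matrix_mul continuous_id.matrix_transpose).matrix_elem i j
  exact h.comp_continuousOn M.continuousOn_diffusion

theorem continuousOn_coeffSize :
    ContinuousOn (Function.uncurry M.coeffSize) (Set.univ ×ˢ closure M.actions) := by
  refine (continuousOn_finsetSum _ fun i _ => (M.continuousOn_drift_apply i).abs).add
    (continuousOn_const.mul (continuousOn_finsetSum _ fun i _ => continuousOn_finsetSum _
      fun j _ => (M.continuousOn_diffusion_apply i j).abs))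

theorem exists_coeffSize_le {K : Set (EuclideanSpace ℝ (Fin n))} (hK : IsCompact K) (r : ℝ) :
    ∃ C, 0 ≤ C ∧ ∀ y ∈ K, ∀ a ∈ M.actions, ‖a‖ ≤ r → M.coeffSize y a ≤ C := by
  have hc : IsCompact (K ×ˢ (closure M.actions ∩ Metric.closedBall 0 r)) :=
    hK.prod ((isCompact_closedBall 0 r).inter_left isClosed_closure)
  obtain ⟨C, hC⟩ := hc.exists_bound_of_continuousOn (f := Function.uncurry M.coeffSize)
    (M.continuousOn_coeffSize.mono (Set.prod_mono (Set.subset_univ _) Set.inter_subset_left))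
  refine ⟨max C 0, le_max_right _ _, fun y hy a ha har => ?_⟩
  have := hC (y, a) ⟨hy, subset_closure ha, by simpa using har⟩
  exact ((le_abs_self _).trans this).trans (le_max_left _ _)

theorem abs_stoppedGenerator_sub_le (a : EuclideanSpace ℝ (Fin m))
    (f g : EuclideanSpace ℝ (Fin n) → ℝ) (y : EuclideanSpace ℝ (Fin n)) :
    |M.stoppedGenerator a f y - M.stoppedGenerator a g y| ≤
      |M.jetGenerator a y (jet f y - jet g y)| := by
  unfold stoppedGenerator
  split_ifs
  · simp
  · rw [generator_eq_jetGenerator, generator_eq_jetGenerator, jetGenerator_sub]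

theorem abs_stoppedGenerator_le (a : EuclideanSpace ℝ (Fin m))
    (f : EuclideanSpace ℝ (Fin n) → ℝ) (y : EuclideanSpace ℝ (Fin n)) :
    |M.stoppedGenerator a f y| ≤ |M.jetGenerator a y (jet f y)| := by
  unfold stoppedGenerator
  split_ifs
  · simp
  · rw [generator_eq_jetGenerator]

/-- The generator of a test function is bounded under bounded actions. -/
theorem exists_stoppedGenerator_bound {f : EuclideanSpace ℝ (Fin n) → ℝ}
    (hf : ContDiff ℝ (⊤ : ℕ∞) f) (hfc : HasCompactSupport f) (r : ℝ) :
    ∃ C, 0 ≤ C ∧ ∀ y, ∀ a ∈ M.actions, ‖a‖ ≤ r → |M.stoppedGenerator a f y| ≤ C := by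
  obtain ⟨C, hC0, hC⟩ := M.exists_coeffSize_le hfc r
  obtain ⟨C', hC'⟩ := hfc.isCompact.exists_bound_of_continuousOn (continuous_jet hf).continuousOn
  refine ⟨C * max C' 0, by positivity, fun y a ha har => ?_⟩
  refine (M.abs_stoppedGenerator_le a f y).trans ?_
  by_cases hy : y ∈ tsupport f
  · exact (M.abs_jetGenerator_le a y _).trans (mul_le_mul (hC y hy a ha har)
      ((hC' y hy).trans (le_max_left _ _)) (norm_nonneg _) hC0)
  · rw [jet_eq_zero_of_notMem hy, jetGenerator_zero, abs_zero]
    positivity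

/-- There is a countable family of test functions which approximates all test functions together
with their first two derivatives. -/
theorem exists_countable_jet_dense (n : ℕ) :
    ∃ D : Set (EuclideanSpace ℝ (Fin n) → ℝ), D.Countable ∧
      (∀ g ∈ D, ContDiff ℝ (⊤ : ℕ∞) g ∧ HasCompactSupport g) ∧
      ∀ f, ContDiff ℝ (⊤ : ℕ∞) f → HasCompactSupport f → ∃ K : Set (EuclideanSpace ℝ (Fin n)),
        IsCompact K ∧ ∀ ε > 0, ∃ g ∈ D, (∀ y ∉ K, jet f y = jet g y) ∧
          ∀ y, ‖jet f y - jet g y‖ ≤ ε := by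
  let T : ℕ → Set (EuclideanSpace ℝ (Fin n) → ℝ) := fun R =>
    {f | ContDiff ℝ (⊤ : ℕ∞) f ∧ tsupport f ⊆ Metric.closedBall 0 R}
  let J : ∀ R : ℕ, T R →
      C(Metric.closedBall (0 : EuclideanSpace ℝ (Fin n)) R,
        ℝ × (Fin n → ℝ) × (Fin n → Fin n → ℝ)) := fun R f =>
    ⟨fun y => jet f.1 y, (continuous_jet f.2.1).comp continuous_subtype_val⟩
  have hdense : ∀ R, ∃ s : Set (T R), s.Countable ∧ ∀ f : T R, ∀ ε > 0, ∃ g ∈ s,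
      dist (J R f) (J R g) ≤ ε := by
    intro R
    -- A subset of a separable metric space is separable, so the approximating jets can be taken
    -- from test functions supported in the same ball.
    obtain ⟨c, hc, hcount, hcl⟩ :=
      (TopologicalSpace.IsSeparable.of_separableSpace
        (Set.range (J R))).exists_countable_dense_subset
    have : Nonempty (T R) := ⟨⟨fun _ => 0, contDiff_const, by simp [tsupport]⟩⟩
    have hc' : ∀ z ∈ c, ∃ f, J R f = z := fun z hz => hc hz
    choose! pre hpre using hc'
    refine ⟨pre '' c, hcount.image _, fun f ε hε => ?_⟩
    obtain ⟨z, hz, hfz⟩ := Metric.mem_closure_iff.1 (hcl (Set.mem_range_self f)) ε hε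
    exact ⟨pre z, Set.mem_image_of_mem _ hz, by rw [hpre z hz]; exact hfz.le⟩
  choose s hs hsd using hdense
  refine ⟨⋃ R, Subtype.val '' s R, Set.countable_iUnion fun R => (hs R).image _, ?_, ?_⟩
  · simp only [Set.mem_iUnion]
    rintro _ ⟨R, g, -, rfl⟩
    exact ⟨g.2.1, (isCompact_closedBall 0 (R : ℝ)).of_isClosed_subset (isClosed_tsupport _) g.2.2⟩
  · intro f hf hfc
    obtain ⟨r, hr⟩ := hfc.isCompact.isBounded.subset_closedBall 0
    obtain ⟨R, hR⟩ := exists_nat_ge r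
    refine ⟨Metric.closedBall 0 R, isCompact_closedBall _ _, fun ε hε => ?_⟩
    have hfR : tsupport f ⊆ Metric.closedBall 0 (R : ℝ) :=
      hr.trans (Metric.closedBall_subset_closedBall hR)
    obtain ⟨g, hg, hfg⟩ := hsd R ⟨f, hf, hfR⟩ ε hε
    have hout : ∀ y ∉ Metric.closedBall (0 : EuclideanSpace ℝ (Fin n)) R, jet f y = jet g.1 y :=
      fun y hy => by
        rw [jet_eq_zero_of_notMem fun h => hy (hfR h), jet_eq_zero_of_notMem fun h => hy (g.2.2 h)]
    refine ⟨g, Set.mem_iUnion.2 ⟨R, g, hg, rfl⟩, hout, fun y => ?_⟩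
    by_cases hy : y ∈ Metric.closedBall (0 : EuclideanSpace ℝ (Fin n)) R
    · have := (ContinuousMap.dist_apply_le_dist (f := J R ⟨f, hf, hfR⟩) (g := J R g)
        ⟨y, hy⟩).trans hfg
      rwa [dist_eq_norm] at this
    · rw [hout y hy, sub_self, norm_zero]
      exact hε.le

/-- There is a countable family of test functions which approximates all test functions together
with their generators. -/
theorem exists_countable_generator_dense :
    ∃ D : Set (EuclideanSpace ℝ (Fin n) → ℝ), D.Countable ∧
      (∀ g ∈ D, ContDiff ℝ (⊤ : ℕ∞) g ∧ HasCompactSupport g) ∧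
      ∀ f, ContDiff ℝ (⊤ : ℕ∞) f → HasCompactSupport f → ∀ r : ℝ, ∀ ε > 0, ∃ g ∈ D,
        (∀ y, |f y - g y| ≤ ε) ∧ ∀ y, ∀ a ∈ M.actions, ‖a‖ ≤ r →
          |M.stoppedGenerator a f y - M.stoppedGenerator a g y| ≤ ε := by
  obtain ⟨D, hD, hDt, hDd⟩ := exists_countable_jet_dense n
  refine ⟨D, hD, hDt, fun f hf hfc r ε hε => ?_⟩
  obtain ⟨K, hK, hKd⟩ := hDd f hf hfc
  obtain ⟨C, hC0, hC⟩ := M.exists_coeffSize_le hK r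
  -- `C` bounds the coefficients on `K`, so jets within `ε / (C + 1)` have generators within `ε`;
  -- the summand `1` makes the values agree within `ε` too.
  obtain ⟨g, hg, hout, hfg⟩ := hKd (ε / (C + 1)) (by positivity)
  have hε' : ε / (C + 1) ≤ ε := div_le_self hε.le (by linarith)
  refine ⟨g, hg, fun y => ((norm_fst_le (jet f y - jet g y)).trans (hfg y)).trans hε',
    fun y a ha har => ?_⟩
  refine (M.abs_stoppedGenerator_sub_le a f g y).trans ?_
  by_cases hy : y ∈ K
  · refine (M.abs_jetGenerator_le a y _).trans ?_
    refine (mul_le_mul (hC y hy a ha har) (hfg y) (norm_nonneg _) hC0).trans ?_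
    rw [mul_div_assoc', div_le_iff₀ (by positivity)]
    nlinarith
  · rw [hout y hy, sub_self, jetGenerator_zero, abs_zero]
    exact hε.le

theorem measurable_of_continuousOn_actions {α β : Type*} [MeasurableSpace α] [TopologicalSpace β]
    [MeasurableSpace β] [BorelSpace β]
    {c : EuclideanSpace ℝ (Fin n) × EuclideanSpace ℝ (Fin m) → β}
    (hc : ContinuousOn c (Set.univ ×ˢ closure M.actions)) {u : α → EuclideanSpace ℝ (Fin m)}
    {X : α → EuclideanSpace ℝ (Fin n)} (hu : Measurable u) (hX : Measurable X)
    (huU : ∀ a, u a ∈ M.actions) : Measurable fun a => c (X a, u a) :=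
  hc.domRestrict.measurable.comp ((hX.prodMk hu).subtype_mk
    (h := fun a => ⟨Set.mem_univ _, subset_closure (huU a)⟩))

theorem measurable_stoppedGenerator {α : Type*} [MeasurableSpace α]
    {u : α → EuclideanSpace ℝ (Fin m)} {X : α → EuclideanSpace ℝ (Fin n)} (hu : Measurable u)
    (hX : Measurable X) (huU : ∀ a, u a ∈ M.actions) {f : EuclideanSpace ℝ (Fin n) → ℝ}
    (hf : ContDiff ℝ (⊤ : ℕ∞) f) : Measurable fun a => M.stoppedGenerator (u a) f (X a) := by
  refine Measurable.ite (M.isClosed_terminal.measurableSet.preimage hX) measurable_const ?_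
  refine Measurable.add (Finset.measurable_sum _ fun i _ => ?_) (measurable_const.mul
    (Finset.measurable_sum _ fun i _ => Finset.measurable_sum _ fun j _ => ?_))
  · exact (M.measurable_of_continuousOn_actions (M.continuousOn_drift_apply i) hu hX huU).mul
      ((contDiff_partialDeriv hf i).continuous.measurable.comp hX)
  · exact (M.measurable_of_continuousOn_actions (M.continuousOn_diffusion_apply i j) hu hX huU).mul
      ((contDiff_partialDeriv (contDiff_partialDeriv hf j) i).continuous.measurable.comp hX)

end DiffusionModel

/-! ### Joint paths, actions read off from them, and test martingales. -/

namespace DiffusionModel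

variable {n m : ℕ}

/-- Paths in the product of the state space and the space of cumulated actions. -/
abbrev JointPath (n m : ℕ) : Type :=
  C(ℝ≥0, EuclideanSpace ℝ (Fin n) × EuclideanSpace ℝ (Fin m))

/-- The left derivative, along a fixed sequence, of the second component of a path. -/
noncomputable def leftVelocity (t : ℝ≥0) (w : JointPath n m) : EuclideanSpace ℝ (Fin m) :=
  limUnder atTop fun k : ℕ => ((k : ℝ) + 1) • ((w t).2 - (w (t - ((k : ℝ≥0) + 1)⁻¹)).2)

theorem measurable_leftVelocity :
    Measurable fun p : JointPath n m × ℝ≥0 => leftVelocity p.2 p.1 := by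
  refine (StronglyMeasurable.limUnder (l := atTop) (f := fun (k : ℕ) (p : JointPath n m × ℝ≥0) =>
    ((k : ℝ) + 1) • ((p.1 p.2).2 - (p.1 (p.2 - ((k : ℝ≥0) + 1)⁻¹)).2)) fun k => ?_).measurable
  have h1 : Measurable fun p : JointPath n m × ℝ≥0 => p.1 p.2 := measurable_uncurry_evalPath
  have h2 : Measurable fun p : JointPath n m × ℝ≥0 => p.1 (p.2 - ((k : ℝ≥0) + 1)⁻¹) :=
    measurable_fst.evalPath (measurable_snd.sub_const _)
  exact ((h1.snd.sub h2.snd).const_smul ((k : ℝ) + 1)).stronglyMeasurable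

/-- The left velocity is determined by the increments of the path shortly before. -/
theorem leftVelocity_congr {t s : ℝ≥0} {w v : JointPath n m}
    (h : ∀ᶠ k : ℕ in atTop, (w t).2 - (w (t - ((k : ℝ≥0) + 1)⁻¹)).2 =
      (v s).2 - (v (s - ((k : ℝ≥0) + 1)⁻¹)).2) : leftVelocity t w = leftVelocity s v := by
  unfold leftVelocity limUnder
  congr 1
  refine Filter.map_congr ?_
  filter_upwards [h] with k hk
  rw [hk]

variable (M : DiffusionModel n m) (a₀ : EuclideanSpace ℝ (Fin m)) (r : ℝ)

open Classical in
/-- The action at time `t` that can be read off from the path of the cumulated actions; `a₀` if this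
is no action of norm at most `r`. -/
noncomputable def pathAction (t : ℝ≥0) (w : JointPath n m) : EuclideanSpace ℝ (Fin m) :=
  if leftVelocity t w ∈ M.actions ∩ Metric.closedBall 0 r then leftVelocity t w else a₀

theorem measurable_pathAction :
    Measurable fun p : JointPath n m × ℝ≥0 => M.pathAction a₀ r p.2 p.1 :=
  Measurable.ite (measurable_leftVelocity
    (M.measurableSet_actions.inter Metric.isClosed_closedBall.measurableSet))
    measurable_leftVelocity measurable_const

theorem pathAction_congr {t s : ℝ≥0} {w v : JointPath n m}
    (h : leftVelocity t w = leftVelocity s v) :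
    M.pathAction a₀ r t w = M.pathAction a₀ r s v := by
  unfold pathAction
  rw [h]

variable {a₀} in
theorem pathAction_mem (ha₀ : a₀ ∈ M.actions) (t : ℝ≥0) (w : JointPath n m) :
    M.pathAction a₀ r t w ∈ M.actions := by
  unfold pathAction
  split_ifs with h
  · exact h.1
  · exact ha₀

theorem norm_pathAction_le (t : ℝ≥0) (w : JointPath n m) :
    ‖M.pathAction a₀ r t w‖ ≤ max r ‖a₀‖ := by
  unfold pathAction
  split_ifs with h
  · exact le_max_of_le_left (by simpa using h.2)
  · exact le_max_right _ _

/-- The velocity is a limit of left difference quotients and so sees only the past. This makes the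
recovered action non-anticipating. -/
theorem pathAction_stopPath {s t : ℝ≥0} (hst : s ≤ t) (w : JointPath n m) :
    M.pathAction a₀ r s (stopPath t w) = M.pathAction a₀ r s w := by
  refine M.pathAction_congr a₀ r (leftVelocity_congr (Eventually.of_forall fun k => ?_))
  rw [stopPath_apply, stopPath_apply, min_eq_left hst, min_eq_left (tsub_le_self.trans hst)]

theorem concatPath_apply_of_le {t ρ : ℝ≥0} (h : t ≤ ρ) (w v : JointPath n m) :
    concatPath ρ w v t = w t := by
  simp [concatPath, min_eq_left h, tsub_eq_zero_of_le h]

theorem concatPath_apply_of_ge {t ρ : ℝ≥0} (h : ρ ≤ t) (w v : JointPath n m) :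
    concatPath ρ w v t = w ρ + (v (t - ρ) - v 0) := by
  simp [concatPath, min_eq_right h]

theorem pathAction_concatPath_of_le {t ρ : ℝ≥0} (h : t ≤ ρ) (w v : JointPath n m) :
    M.pathAction a₀ r t (concatPath ρ w v) = M.pathAction a₀ r t w := by
  refine M.pathAction_congr a₀ r (leftVelocity_congr (Eventually.of_forall fun k => ?_))
  rw [concatPath_apply_of_le h, concatPath_apply_of_le (tsub_le_self.trans h)]

theorem eventually_inv_lt {t : ℝ≥0} (h : 0 < t) : ∀ᶠ k : ℕ in atTop, ((k : ℝ≥0) + 1)⁻¹ < t := by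
  have := (tendsto_order.1 (tendsto_one_div_add_atTop_nhds_zero_nat (𝕜 := ℝ))).2 (t : ℝ) h
  filter_upwards [this] with k hk
  rw [← NNReal.coe_lt_coe]
  simpa using hk

/-- The inequality is strict because the left quotients at `ρ` still see `w`. For `t > ρ` they
eventually involve only times from `ρ` on, and the constant added in the concatenation cancels. -/
theorem pathAction_concatPath_of_gt {t ρ : ℝ≥0} (h : ρ < t) (w v : JointPath n m) :
    M.pathAction a₀ r t (concatPath ρ w v) = M.pathAction a₀ r (t - ρ) v := by
  refine M.pathAction_congr a₀ r (leftVelocity_congr ?_)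
  filter_upwards [eventually_inv_lt (tsub_pos_of_lt h)] with k hk
  have h' : ρ ≤ t - ((k : ℝ≥0) + 1)⁻¹ := by
    rw [lt_tsub_iff_left] at hk
    exact le_tsub_of_add_le_right hk.le
  rw [concatPath_apply_of_ge h.le, concatPath_apply_of_ge h', tsub_right_comm]
  simp

/-- The generator along a path. -/
noncomputable def pathGenerator (f : EuclideanSpace ℝ (Fin n) → ℝ) (t : ℝ≥0)
    (w : JointPath n m) : ℝ :=
  M.stoppedGenerator (M.pathAction a₀ r t w) f (w t).1

/-- The process which has to be a martingale in the martingale problem. -/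
noncomputable def testMartingale (f : EuclideanSpace ℝ (Fin n) → ℝ) (t : ℝ≥0)
    (w : JointPath n m) : ℝ :=
  f (w t).1 - ∫ s in (0 : ℝ)..t, M.pathGenerator a₀ r f s.toNNReal w

variable {a₀} {f : EuclideanSpace ℝ (Fin n) → ℝ}

theorem measurable_pathGenerator (ha₀ : a₀ ∈ M.actions) (hf : ContDiff ℝ (⊤ : ℕ∞) f) :
    Measurable fun p : JointPath n m × ℝ≥0 => M.pathGenerator a₀ r f p.2 p.1 :=
  M.measurable_stoppedGenerator (M.measurable_pathAction a₀ r) measurable_uncurry_evalPath.fst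
    (fun _ => M.pathAction_mem r ha₀ _ _) hf

theorem exists_pathGenerator_bound (ha₀ : a₀ ∈ M.actions) (hf : ContDiff ℝ (⊤ : ℕ∞) f)
    (hfc : HasCompactSupport f) :
    ∃ C, 0 ≤ C ∧ ∀ t w, |M.pathGenerator a₀ r f t w| ≤ C := by
  obtain ⟨C, hC0, hC⟩ := M.exists_stoppedGenerator_bound hf hfc (max r ‖a₀‖)
  exact ⟨C, hC0, fun t w => hC _ _ (M.pathAction_mem r ha₀ t w) (M.norm_pathAction_le a₀ r t w)⟩

theorem intervalIntegrable_pathGenerator (ha₀ : a₀ ∈ M.actions) (hf : ContDiff ℝ (⊤ : ℕ∞) f)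
    (hfc : HasCompactSupport f) (w : JointPath n m) (a b : ℝ) :
    IntervalIntegrable (fun s : ℝ => M.pathGenerator a₀ r f s.toNNReal w) volume a b := by
  obtain ⟨C, -, hC⟩ := M.exists_pathGenerator_bound r ha₀ hf hfc
  refine (intervalIntegrable_const (c := C)).mono_fun ?_ (Eventually.of_forall fun s => ?_)
  · exact ((M.measurable_pathGenerator r ha₀ hf).comp
      (measurable_const.prodMk measurable_real_toNNReal)).aestronglyMeasurable
  · exact (hC _ _).trans (le_abs_self C)

theorem measurable_testMartingale (ha₀ : a₀ ∈ M.actions) (hf : ContDiff ℝ (⊤ : ℕ∞) f) (t : ℝ≥0) :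
    Measurable (M.testMartingale a₀ r f t) := by
  refine (hf.continuous.measurable.comp (measurable_evalPath t).fst).sub ?_
  simp only [intervalIntegral.integral_of_le t.coe_nonneg]
  refine (StronglyMeasurable.integral_prod_right (f := fun (w : JointPath n m) (s : ℝ) =>
    M.pathGenerator a₀ r f s.toNNReal w) ?_).measurable
  exact ((M.measurable_pathGenerator r ha₀ hf).comp
    (measurable_fst.prodMk (measurable_real_toNNReal.comp measurable_snd))).stronglyMeasurable

theorem continuous_testMartingale (ha₀ : a₀ ∈ M.actions) (hf : ContDiff ℝ (⊤ : ℕ∞) f)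
    (hfc : HasCompactSupport f) (w : JointPath n m) :
    Continuous fun t => M.testMartingale a₀ r f t w :=
  (hf.continuous.comp w.continuous.fst).sub
    ((intervalIntegral.continuous_primitive
      (M.intervalIntegrable_pathGenerator r ha₀ hf hfc w) 0).comp NNReal.continuous_coe)

theorem exists_testMartingale_bound (ha₀ : a₀ ∈ M.actions) (hf : ContDiff ℝ (⊤ : ℕ∞) f)
    (hfc : HasCompactSupport f) (t : ℝ≥0) :
    ∃ C, ∀ s ≤ t, ∀ w, |M.testMartingale a₀ r f s w| ≤ C := by
  obtain ⟨C, hC0, hC⟩ := M.exists_pathGenerator_bound r ha₀ hf hfc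
  obtain ⟨C', hC'⟩ := hf.continuous.bounded_above_of_compact_support hfc
  refine ⟨C' + C * t, fun s hs w => (abs_sub _ _).trans (add_le_add (hC' _) ?_)⟩
  have := intervalIntegral.norm_integral_le_of_norm_le_const (a := (0 : ℝ)) (b := s) (C := C)
    (f := fun s : ℝ => M.pathGenerator a₀ r f s.toNNReal w) fun x _ => hC _ _
  refine this.trans ?_
  rw [sub_zero, abs_of_nonneg s.coe_nonneg]
  exact mul_le_mul_of_nonneg_left (by exact_mod_cast hs) hC0

theorem testMartingale_zero (w : JointPath n m) : M.testMartingale a₀ r f 0 w = f (w 0).1 := by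
  simp [testMartingale]

theorem testMartingale_congr {t : ℝ≥0} {w v : JointPath n m} (h : (w t).1 = (v t).1)
    (h' : ∀ s ≤ t, 0 < s → M.pathGenerator a₀ r f s w = M.pathGenerator a₀ r f s v) :
    M.testMartingale a₀ r f t w = M.testMartingale a₀ r f t v := by
  unfold testMartingale
  rw [h]
  congr 1
  -- The integral runs over `(0, t]`, so the action at time `0`, which has no past, is irrelevant.
  refine intervalIntegral.integral_congr_ae (Eventually.of_forall fun s hs => ?_)
  rw [Set.uIoc_of_le t.coe_nonneg] at hs
  exact h' _ (Real.toNNReal_le_iff_le_coe.2 hs.2) (Real.toNNReal_pos.2 hs.1)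

theorem testMartingale_stopPath {s t : ℝ≥0} (hst : s ≤ t) (w : JointPath n m) :
    M.testMartingale a₀ r f s (stopPath t w) = M.testMartingale a₀ r f s w := by
  refine M.testMartingale_congr r (by simp [hst]) fun q hq _ => ?_
  rw [pathGenerator, pathGenerator, M.pathAction_stopPath a₀ r (hq.trans hst), stopPath_apply,
    min_eq_left (hq.trans hst)]

theorem testMartingale_concatPath_of_le {t ρ : ℝ≥0} (h : t ≤ ρ) (w v : JointPath n m) :
    M.testMartingale a₀ r f t (concatPath ρ w v) = M.testMartingale a₀ r f t w := by
  refine M.testMartingale_congr r (by rw [concatPath_apply_of_le h]) fun q hq _ => ?_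
  rw [pathGenerator, pathGenerator, M.pathAction_concatPath_of_le a₀ r (hq.trans h),
    concatPath_apply_of_le (hq.trans h)]

/-- The time integral splits at `ρ` and its later part is a shift of the one for `v`. This
additivity is what lets martingale properties be pasted together. -/
theorem testMartingale_concatPath_of_ge (ha₀ : a₀ ∈ M.actions) (hf : ContDiff ℝ (⊤ : ℕ∞) f)
    (hfc : HasCompactSupport f) {t ρ : ℝ≥0} (h : ρ ≤ t) {w v : JointPath n m}
    (hv : (v 0).1 = (w ρ).1) :
    M.testMartingale a₀ r f t (concatPath ρ w v) =
      M.testMartingale a₀ r f ρ w +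
        (M.testMartingale a₀ r f (t - ρ) v - M.testMartingale a₀ r f 0 v) := by
  have hX : ∀ s, ρ ≤ s → (concatPath ρ w v s).1 = (v (s - ρ)).1 := fun s hs => by
    rw [concatPath_apply_of_ge hs, Prod.fst_add, Prod.fst_sub, hv, add_sub_cancel]
  have hII := fun w => M.intervalIntegrable_pathGenerator r ha₀ hf hfc (a₀ := a₀) w
  have h1 := M.testMartingale_concatPath_of_le (a₀ := a₀) (f := f) r (le_refl ρ) w v
  rw [← h1, testMartingale_zero]
  unfold testMartingale
  rw [hX t h, hX ρ le_rfl, tsub_self,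
    ← intervalIntegral.integral_add_adjacent_intervals (hII _ 0 ρ) (hII _ ρ t)]
  have hshift : ∫ s in (ρ : ℝ)..t, M.pathGenerator a₀ r f s.toNNReal (concatPath ρ w v) =
      ∫ s in (0 : ℝ)..(t - ρ : ℝ≥0), M.pathGenerator a₀ r f s.toNNReal v := by
    have := intervalIntegral.integral_comp_sub_right (a := (ρ : ℝ)) (b := t)
      (fun s : ℝ => M.pathGenerator a₀ r f s.toNNReal v) ρ
    rw [sub_self, ← NNReal.coe_sub h] at this
    rw [← this]
    refine intervalIntegral.integral_congr_ae (Eventually.of_forall fun s hs => ?_)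
    rw [Set.uIoc_of_le (by exact_mod_cast h)] at hs
    have hs' : ρ < s.toNNReal := Real.lt_toNNReal_iff_coe_lt.2 hs.1
    simp only [pathGenerator]
    rw [M.pathAction_concatPath_of_gt a₀ r hs', hX _ hs'.le, NNReal.sub_def,
      Real.coe_toNNReal _ (ρ.coe_nonneg.trans hs.1.le)]
  rw [hshift]
  ring

end DiffusionModel

/-! ### Solutions as laws on path space, and their equivalence with controlled diffusions. -/

namespace DiffusionModel

variable {n m : ℕ} (M : DiffusionModel n m)

/-- A trajectory which stays where it is once it is at a terminal state. -/
def IsAbsorbed (w : ℝ≥0 → EuclideanSpace ℝ (Fin n)) : Prop :=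
  ∀ s t, s ≤ t → w s ∈ M.terminal → w t = w s

variable {M} in
/-- A continuous absorbed trajectory that is at a marking state has completed the event. -/
theorem IsAbsorbed.occursBy {w : ℝ≥0 → EuclideanSpace ℝ (Fin n)} (hw : M.IsAbsorbed w)
    (hc : Continuous w) {B : Set (EuclideanSpace ℝ (Fin n))} (hB : B ⊆ M.terminal) {t : ℝ≥0}
    (ht : w t ∈ B) : M.OccursBy B w t := by
  have hcl : IsClosed {s | w s ∈ M.terminal} := M.isClosed_terminal.preimage hc
  have hmem : sInf {s | w s ∈ M.terminal} ∈ {s | w s ∈ M.terminal} :=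
    hcl.csInf_mem ⟨t, hB ht⟩ (OrderBot.bddBelow _)
  have hle : ∀ r, w r ∈ M.terminal → sInf {s | w s ∈ M.terminal} ≤ r := fun r hr => csInf_le' hr
  refine ⟨sInf {s | w s ∈ M.terminal}, hle t (hB ht), ?_, fun r hr h => (hle r h).not_gt hr⟩
  rwa [← hw _ t (hle t (hB ht)) hmem]

variable {M} in
/-- Along a continuous absorbed trajectory, an event occurs if and only if the trajectory is in the
set of marking states at some integer time. -/
theorem IsAbsorbed.occurs_iff {w : ℝ≥0 → EuclideanSpace ℝ (Fin n)} (hw : M.IsAbsorbed w)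
    (hc : Continuous w) {B : Set (EuclideanSpace ℝ (Fin n))} (hB : B ⊆ M.terminal) :
    M.Occurs B w ↔ ∃ k : ℕ, w k ∈ B := by
  constructor
  · rintro ⟨-, s, -, hs, -⟩
    obtain ⟨k, hk⟩ := exists_nat_ge s
    exact ⟨k, by rwa [hw s k hk (hB hs)]⟩
  · rintro ⟨k, hk⟩
    exact ⟨k, hw.occursBy hc hB hk⟩

/-- Dense times suffice: a path that has met the closed terminal set by `d i` has equal values at `d
i` and every later `d j`, and continuity extends this to all times. -/
theorem measurableSet_isAbsorbed :
    MeasurableSet {w : JointPath n m | M.IsAbsorbed fun t => (w t).1} := by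
  let d := TopologicalSpace.denseSeq ℝ≥0
  have : {w : JointPath n m | M.IsAbsorbed fun t => (w t).1} = ⋂ i, ⋂ j, ⋂ (_ : d i ≤ d j),
      ((hitBy (Prod.fst ⁻¹' M.terminal) (d i))ᶜ ∪ {w | (w (d j)).1 = (w (d i)).1}) := by
    ext w
    simp only [Set.mem_iInter, Set.mem_union, Set.mem_compl_iff, Set.mem_ofPred_eq]
    constructor
    · intro h i j hij
      refine or_iff_not_imp_left.2 fun hi => ?_
      obtain ⟨s, hs, hsZ⟩ := not_not.1 hi
      exact (h s (d j) (hs.trans hij) hsZ).trans (h s (d i) hs hsZ).symm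
    · intro h s t hst hsZ
      have key : ∀ i j, s < d i → s < d j → (w (d j)).1 = (w (d i)).1 := by
        intro i j hi hj
        rcases le_total (d i) (d j) with hij | hij
        · exact (h i j hij).resolve_left fun hn => hn ⟨s, hi.le, hsZ⟩
        · exact ((h j i hij).resolve_left fun hn => hn ⟨s, hj.le, hsZ⟩).symm
      have hdense := TopologicalSpace.denseRange_denseSeq ℝ≥0
      obtain ⟨i, hi⟩ := hdense.exists_mem_open (isOpen_Ioi (a := s)) ⟨s + 1, by simp⟩
      have hcl : IsClosed {q | (w q).1 = (w (d i)).1} :=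
        isClosed_eq w.continuous.fst continuous_const
      have hsub : Set.Ici s ⊆ {q | (w q).1 = (w (d i)).1} := by
        rw [← closure_Ioi s]
        refine closure_minimal ((hdense.open_subset_closure_inter isOpen_Ioi).trans
          (closure_minimal ?_ hcl)) hcl
        rintro _ ⟨hq, j, rfl⟩
        exact key i j hi hq
      have h1 : (w t).1 = (w (d i)).1 := hsub hst
      have h2 : (w s).1 = (w (d i)).1 := hsub (Set.self_mem_Ici)
      exact h1.trans h2.symm
  rw [this]
  refine .iInter fun i => .iInter fun j => .iInter fun _ => MeasurableSet.union
    (measurableSet_hitBy (M.isClosed_terminal.preimage continuous_fst) _).compl ?_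
  exact measurableSet_eq_fun (measurable_evalPath _).fst (measurable_evalPath _).fst

/-- The distribution of a pair of a state process and its cumulated actions, such that the state
process is a controlled diffusion from `y` under the actions `pathAction`. -/
structure IsSolution (a₀ : EuclideanSpace ℝ (Fin m)) (r : ℝ) (y : EuclideanSpace ℝ (Fin n))
    (Q : Measure (JointPath n m)) : Prop where
  isProbabilityMeasure : IsProbabilityMeasure Q
  start : ∀ᵐ w ∂Q, (w 0).1 = y
  absorbed : ∀ᵐ w ∂Q, M.IsAbsorbed fun t => (w t).1
  martingale : ∀ f, ContDiff ℝ (⊤ : ℕ∞) f → HasCompactSupport f → ∀ s t, s ≤ t → ∀ G,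
    MeasurableSet[pathFiltration _ s] G →
      ∫ w in G, (M.testMartingale a₀ r f t w - M.testMartingale a₀ r f s w) ∂Q = 0

variable {M}
variable {a₀ : EuclideanSpace ℝ (Fin m)} {r : ℝ} {y : EuclideanSpace ℝ (Fin n)}

theorem integrable_testMartingale (Q : Measure (JointPath n m)) [IsFiniteMeasure Q]
    (ha₀ : a₀ ∈ M.actions) {f : EuclideanSpace ℝ (Fin n) → ℝ} (hf : ContDiff ℝ (⊤ : ℕ∞) f)
    (hfc : HasCompactSupport f) (t : ℝ≥0) : Integrable (M.testMartingale a₀ r f t) Q := by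
  obtain ⟨C, hC⟩ := M.exists_testMartingale_bound r ha₀ hf hfc t
  exact Integrable.of_bound (M.measurable_testMartingale r ha₀ hf t).aestronglyMeasurable C
    (Eventually.of_forall fun w => hC t le_rfl w)

/-- The canonical process of a solution is a controlled diffusion. -/
noncomputable def IsSolution.toControlledDiffusion {Q : Measure (JointPath n m)}
    (hQ : M.IsSolution a₀ r y Q) (ha₀ : a₀ ∈ M.actions) : M.ControlledDiffusion y where
  Ω := JointPath n m
  P := Q
  isProbabilityMeasure := hQ.isProbabilityMeasure
  ℱ := pathFiltration _
  X t w := (w t).1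
  u t w := M.pathAction a₀ r t w
  continuous_X w := w.continuous.fst
  adapted_X t := (measurable_pathFiltration (measurable_evalPath t).fst
    fun w => by simp).stronglyMeasurable
  progressive_u t := by
    have h : Measurable[(inferInstance : MeasurableSpace (Set.Iic t)).prod (pathFiltration _ t)]
        fun p : Set.Iic t × JointPath n m => (stopPath t p.2, (p.1 : ℝ≥0)) := by
      refine Measurable.prodMk ?_ (measurable_subtype_coe.comp measurable_fst)
      exact (measurable_stopPath_pathFiltration t).comp measurable_snd
    have heq : (fun p : Set.Iic t × JointPath n m => M.pathAction a₀ r p.1 p.2) =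
        (fun q : JointPath n m × ℝ≥0 => M.pathAction a₀ r q.2 q.1) ∘
          fun p : Set.Iic t × JointPath n m => (stopPath t p.2, (p.1 : ℝ≥0)) :=
      funext fun p => (M.pathAction_stopPath a₀ r p.1.2 p.2).symm
    rw [heq]
    exact ((M.measurable_pathAction a₀ r).comp h).stronglyMeasurable
  u_mem t w := M.pathAction_mem r ha₀ t w
  u_bounded := ⟨_, fun t w => M.norm_pathAction_le a₀ r t w⟩
  X_zero := hQ.start
  absorbed := hQ.absorbed
  martingale f hf hfc := by
    have := hQ.isProbabilityMeasure
    have hadapt : ∀ t, StronglyMeasurable[pathFiltration _ t]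
        (M.testMartingale a₀ r f t) := fun t => (measurable_pathFiltration (M.measurable_testMartingale r ha₀ hf t)
        fun w => M.testMartingale_stopPath r le_rfl w).stronglyMeasurable
    have hint := fun t => integrable_testMartingale (r := r) Q ha₀ hf hfc t
    refine ⟨hadapt, fun s t hst => ?_⟩
    refine (ae_eq_condExp_of_forall_setIntegral_eq ((pathFiltration _).le s) (hint t)
      (fun G _ _ => (hint s).integrableOn) (fun G hG _ => ?_)
      (hadapt s).aestronglyMeasurable).symm
    have h := hQ.martingale f hf hfc s t hst G hG
    rw [integral_sub (hint t).integrableOn (hint s).integrableOn, sub_eq_zero] at h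
    exact h.symm

namespace ControlledDiffusion

variable (S : M.ControlledDiffusion y)

/-- Progressive measurability concerns functions on `Set.Iic t × Ω`. Capping the time at `t` extends
it to all real times, as needed for time integrals to be `ℱ t`-measurable. -/
theorem measurable_action_min (t : ℝ≥0) :
    Measurable[(inferInstance : MeasurableSpace ℝ).prod (S.ℱ t)]
      fun p : ℝ × S.Ω => S.u (min p.1.toNNReal t) p.2 := by
  have h := (S.progressive_u t).measurable
  have h' : Measurable[(inferInstance : MeasurableSpace ℝ).prod (S.ℱ t),
      (inferInstance : MeasurableSpace (Set.Iic t)).prod (S.ℱ t)]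
      fun p : ℝ × S.Ω =>
        ((⟨min p.1.toNNReal t, Set.mem_Iic.2 (min_le_right _ _)⟩ : Set.Iic t), p.2) := by
    refine Measurable.prodMk ?_ measurable_snd
    exact ((measurable_real_toNNReal.comp measurable_fst).min measurable_const).subtype_mk
  exact h.comp h'

theorem measurable_action (ω : S.Ω) : Measurable fun s : ℝ => S.u s.toNNReal ω := by
  refine measurable_of_tendsto_metrizable
    (f := fun (k : ℕ) (s : ℝ) => S.u (min s.toNNReal k) ω) (fun k => ?_) ?_
  · have := S.measurable_action_min k
    exact (this.mono (sup_le_sup le_rfl (MeasurableSpace.comap_mono (S.ℱ.le k))) le_rfl).comp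
      (measurable_id.prodMk measurable_const)
  · rw [tendsto_pi_nhds]
    intro s
    obtain ⟨N, hN⟩ := exists_nat_ge s.toNNReal
    refine tendsto_const_nhds.congr' ?_
    filter_upwards [eventually_ge_atTop N] with k hk
    rw [min_eq_left (hN.trans (by exact_mod_cast hk))]

theorem locallyIntegrable_action (ω : S.Ω) :
    LocallyIntegrable fun s : ℝ => S.u s.toNNReal ω := by
  obtain ⟨C, hC⟩ := S.u_bounded
  exact (locallyIntegrable_const C).mono (S.measurable_action ω).aestronglyMeasurable
    (Eventually.of_forall fun s => (hC _ _).trans (le_abs_self C))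

theorem intervalIntegrable_action (ω : S.Ω) (a b : ℝ) :
    IntervalIntegrable (fun s : ℝ => S.u s.toNNReal ω) volume a b :=
  intervalIntegrable_iff.2 (((S.locallyIntegrable_action ω).integrableOn_isCompact
    isCompact_uIcc).mono_set Set.uIoc_subset_uIcc)

/-- The joint path of the state process and the cumulated actions. -/
noncomputable def path (ω : S.Ω) : JointPath n m :=
  ⟨fun t => (S.X t ω, ∫ s in (0 : ℝ)..t, S.u s.toNNReal ω), (S.continuous_X ω).prodMk
    ((intervalIntegral.continuous_primitive (S.intervalIntegrable_action ω) 0).comp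
      NNReal.continuous_coe)⟩

@[simp]
theorem path_fst (ω : S.Ω) (t : ℝ≥0) : (S.path ω t).1 = S.X t ω := rfl

theorem measurable_path_apply (t : ℝ≥0) : Measurable[S.ℱ t] fun ω => S.path ω t := by
  refine (S.adapted_X t).measurable.prodMk ?_
  have : (fun ω => ∫ s in (0 : ℝ)..t, S.u s.toNNReal ω) =
      fun ω => ∫ s in Set.Ioc (0 : ℝ) t, S.u (min s.toNNReal t) ω := by
    funext ω
    rw [intervalIntegral.integral_of_le t.coe_nonneg]
    refine setIntegral_congr_fun measurableSet_Ioc fun s hs => ?_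
    rw [min_eq_left (Real.toNNReal_le_iff_le_coe.2 hs.2)]
  rw [this]
  exact (@StronglyMeasurable.integral_prod_left' ℝ S.Ω _ inferInstance (S.ℱ t) _ _ _ _ _
    (S.measurable_action_min t).stronglyMeasurable).measurable

theorem measurable_stopPath_path (t : ℝ≥0) : Measurable[S.ℱ t] fun ω => stopPath t (S.path ω) := by
  refine @measurable_path_of_eval _ _ _ _ _ _ S.Ω (S.ℱ t) _ fun s => ?_
  exact (S.measurable_path_apply (min s t)).mono (S.ℱ.mono (min_le_right _ _)) le_rfl

theorem measurable_path : Measurable S.path :=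
  measurable_path_of_eval fun t => (S.measurable_path_apply t).mono (S.ℱ.le t) le_rfl

/-- This is Lebesgue's differentiation theorem for the integral of the action. The exceptional times
form a null set, which time integrals of the generator do not see. -/
theorem leftVelocity_path (ω : S.Ω) :
    ∀ᵐ s : ℝ, 0 < s → leftVelocity s.toNNReal (S.path ω) = S.u s.toNNReal ω := by
  filter_upwards [LocallyIntegrable.ae_hasDerivAt_integral (S.locallyIntegrable_action ω)]
    with s hs hs0
  refine Tendsto.limUnder_eq ?_
  have h1 := hasDerivAt_iff_tendsto_slope.1 (hs 0)
  have h2 : Tendsto (fun k : ℕ => s - ((k : ℝ) + 1)⁻¹) atTop (𝓝[≠] s) := by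
    refine tendsto_nhdsWithin_iff.2 ⟨?_, Eventually.of_forall fun k => ?_⟩
    · have := (tendsto_one_div_add_atTop_nhds_zero_nat (𝕜 := ℝ)).const_sub s
      simpa using this
    · have : (0 : ℝ) < ((k : ℝ) + 1)⁻¹ := by positivity
      simpa using this.ne'
  refine (h1.comp h2).congr' ?_
  -- Once `1 / (k + 1) < s`, truncated subtraction in `ℝ≥0` is ordinary subtraction.
  filter_upwards [eventually_inv_lt (Real.toNNReal_pos.2 hs0)] with k hk
  have h3 : ((s.toNNReal - ((k : ℝ≥0) + 1)⁻¹ : ℝ≥0) : ℝ) = s - ((k : ℝ) + 1)⁻¹ := by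
    rw [NNReal.coe_sub hk.le, Real.coe_toNNReal s hs0.le]
    simp
  simp only [Function.comp_apply, slope, path, ContinuousMap.coe_mk, h3, Real.coe_toNNReal s hs0.le,
    vsub_eq_sub]
  rw [sub_sub_cancel_left, inv_neg, inv_inv, neg_smul, ← smul_neg, neg_sub]

theorem pathGenerator_path {C : ℝ} (hC : ∀ t ω, ‖S.u t ω‖ ≤ C) (hr : C ≤ r)
    (f : EuclideanSpace ℝ (Fin n) → ℝ) (ω : S.Ω) :
    ∀ᵐ s : ℝ, 0 < s → M.pathGenerator a₀ r f s.toNNReal (S.path ω) =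
      M.stoppedGenerator (S.u s.toNNReal ω) f (S.X s.toNNReal ω) := by
  filter_upwards [S.leftVelocity_path ω] with s hs hs0
  rw [pathGenerator, pathAction, hs hs0, if_pos ⟨S.u_mem _ _, by simpa using (hC _ _).trans hr⟩,
    path_fst]

theorem testMartingale_path {C : ℝ} (hC : ∀ t ω, ‖S.u t ω‖ ≤ C) (hr : C ≤ r)
    (f : EuclideanSpace ℝ (Fin n) → ℝ) (t : ℝ≥0) (ω : S.Ω) :
    M.testMartingale a₀ r f t (S.path ω) = f (S.X t ω) -
      ∫ s in (0 : ℝ)..t, M.stoppedGenerator (S.u s.toNNReal ω) f (S.X s.toNNReal ω) := by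
  unfold testMartingale
  congr 1
  refine intervalIntegral.integral_congr_ae ?_
  filter_upwards [S.pathGenerator_path (a₀ := a₀) hC hr f ω] with s hs hst
  rw [Set.uIoc_of_le t.coe_nonneg] at hst
  exact hs hst.1

/-- The distribution of the joint path of a controlled diffusion is a solution. -/
theorem isSolution_map_path (ha₀ : a₀ ∈ M.actions) {C : ℝ} (hC : ∀ t ω, ‖S.u t ω‖ ≤ C)
    (hr : C ≤ r) : M.IsSolution a₀ r y (S.P.map S.path) where
  isProbabilityMeasure := Measure.isProbabilityMeasure_map S.measurable_path.aemeasurable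
  start := by
    refine (ae_map_iff S.measurable_path.aemeasurable ?_).2 S.X_zero
    exact (measurable_evalPath 0).fst (measurableSet_singleton y)
  absorbed := (ae_map_iff S.measurable_path.aemeasurable M.measurableSet_isAbsorbed).2 S.absorbed
  martingale f hf hfc s t hst G hG := by
    have hint : ∀ t, Integrable (fun ω => f (S.X t ω) - ∫ s in (0 : ℝ)..t,
        M.stoppedGenerator (S.u s.toNNReal ω) f (S.X s.toNNReal ω)) S.P :=
      fun t => (S.martingale f hf hfc).integrable t
    have hmeas : Measurable fun w => M.testMartingale a₀ r f t w - M.testMartingale a₀ r f s w :=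
      (M.measurable_testMartingale r ha₀ hf t).sub (M.measurable_testMartingale r ha₀ hf s)
    rw [setIntegral_map ((pathFiltration _).le s G hG) hmeas.aestronglyMeasurable
      S.measurable_path.aemeasurable]
    simp only [S.testMartingale_path hC hr]
    rw [integral_sub (hint t).integrableOn (hint s).integrableOn, sub_eq_zero]
    refine ((S.martingale f hf hfc).setIntegral_eq hst ?_).symm
    obtain ⟨G', hG', rfl⟩ := hG
    exact S.measurable_stopPath_path s hG'

end ControlledDiffusion

end DiffusionModel

/-! ### Reduction of the martingale problem to countably many conditions. -/

/-- If the integrals of a function vanish over the sets of a `π`-system that contains the whole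
space, then they vanish over all sets of the generated `σ`-algebra. -/
theorem setIntegral_eq_zero_of_generateFrom {α : Type*} {m m0 : MeasurableSpace α} (hm : m ≤ m0)
    {μ : Measure α} {h : α → ℝ} (hh : Integrable h μ) {S : Set (Set α)}
    (hS : m = MeasurableSpace.generateFrom S) (hpi : IsPiSystem S) (huniv : Set.univ ∈ S)
    (h0 : ∀ G ∈ S, ∫ x in G, h x ∂μ = 0) {G : Set α} (hG : MeasurableSet[m] G) :
    ∫ x in G, h x ∂μ = 0 := by
  induction G, hG using MeasurableSpace.induction_on_inter hS hpi with
  | empty => simp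
  | basic G hG => exact h0 G hG
  | compl G hG ih =>
    have h1 := integral_add_compl (hm _ hG) hh
    have h2 := h0 _ huniv
    rw [setIntegral_univ] at h2
    linarith
  | iUnion G hd hG ih =>
    rw [integral_iUnion (fun i => hm _ (hG i)) hd hh.integrableOn]
    simp [ih]

namespace DiffusionModel

variable {n m : ℕ} {M : DiffusionModel n m} {a₀ : EuclideanSpace ℝ (Fin m)} {r : ℝ}
  {y : EuclideanSpace ℝ (Fin n)}

/-- Dominated convergence applies since test martingales are bounded on bounded time intervals. This
carries martingale identities from dense times to all times. -/
theorem continuous_setIntegral_testMartingale (Q : Measure (JointPath n m)) [IsFiniteMeasure Q]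
    (ha₀ : a₀ ∈ M.actions) {f : EuclideanSpace ℝ (Fin n) → ℝ} (hf : ContDiff ℝ (⊤ : ℕ∞) f)
    (hfc : HasCompactSupport f) (G : Set (JointPath n m)) :
    Continuous fun t => ∫ w in G, M.testMartingale a₀ r f t w ∂Q := by
  refine continuous_iff_continuousAt.2 fun t => ?_
  obtain ⟨C, hC⟩ := M.exists_testMartingale_bound r ha₀ hf hfc (t + 1)
  refine continuousAt_of_dominated (bound := fun _ => C)
    (Eventually.of_forall fun s => (M.measurable_testMartingale r ha₀ hf s).aestronglyMeasurable)
    ?_ (integrable_const C) (Eventually.of_forall fun w =>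
      (M.continuous_testMartingale r ha₀ hf hfc w).continuousAt)
  filter_upwards [Iic_mem_nhds (show t < t + 1 by simp)] with s hs
  exact Eventually.of_forall fun w => hC s hs w

theorem abs_testMartingale_sub_le (ha₀ : a₀ ∈ M.actions) {f g : EuclideanSpace ℝ (Fin n) → ℝ}
    (hf : ContDiff ℝ (⊤ : ℕ∞) f) (hfc : HasCompactSupport f) (hg : ContDiff ℝ (⊤ : ℕ∞) g)
    (hgc : HasCompactSupport g) {ε : ℝ} (h : ∀ y, |f y - g y| ≤ ε)
    (h' : ∀ y, ∀ a ∈ M.actions, ‖a‖ ≤ max r ‖a₀‖ →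
      |M.stoppedGenerator a f y - M.stoppedGenerator a g y| ≤ ε) (t : ℝ≥0) (w : JointPath n m) :
    |M.testMartingale a₀ r f t w - M.testMartingale a₀ r g t w| ≤ ε + ε * t := by
  unfold testMartingale
  rw [sub_sub_sub_comm, ← intervalIntegral.integral_sub
    (M.intervalIntegrable_pathGenerator r ha₀ hf hfc w 0 t)
    (M.intervalIntegrable_pathGenerator r ha₀ hg hgc w 0 t)]
  refine (abs_sub _ _).trans (add_le_add (h _) ?_)
  have := intervalIntegral.norm_integral_le_of_norm_le_const (a := (0 : ℝ)) (b := t) (C := ε)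
    (f := fun s : ℝ => M.pathGenerator a₀ r f s.toNNReal w - M.pathGenerator a₀ r g s.toNNReal w)
    fun x _ => h' _ _ (M.pathAction_mem r ha₀ _ _) (M.norm_pathAction_le a₀ r _ _)
  rwa [sub_zero, abs_of_nonneg t.coe_nonneg] at this

variable (M) in
/-- The martingale property needs to be checked only for countably many test functions, times and
events. -/
theorem exists_countable_martingale_conditions (ha₀ : a₀ ∈ M.actions) (r : ℝ) :
    ∃ I : Set ((JointPath n m → ℝ) × Set (JointPath n m)), I.Countable ∧
      (∀ p ∈ I, Measurable p.1 ∧ MeasurableSet p.2) ∧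
      ∀ (y : EuclideanSpace ℝ (Fin n)) (Q : Measure (JointPath n m)), IsProbabilityMeasure Q →
        (M.IsSolution a₀ r y Q ↔ (∀ᵐ w ∂Q, (w 0).1 = y) ∧
          (∀ᵐ w ∂Q, M.IsAbsorbed fun t => (w t).1) ∧
          ∀ p ∈ I, ∫ w in p.2, p.1 w ∂Q = 0) := by
  obtain ⟨D, hD, hDt, hDd⟩ := M.exists_countable_generator_dense
  let d := TopologicalSpace.denseSeq ℝ≥0
  have hpi : ∀ i, ∃ S : Set (Set (JointPath n m)), S.Countable ∧ IsPiSystem S ∧ Set.univ ∈ S ∧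
      (pathFiltration _ (d i) : MeasurableSpace (JointPath n m)) =
        MeasurableSpace.generateFrom S := fun i =>
    @exists_countable_isPiSystem_generateFrom _ (pathFiltration _ (d i))
      (MeasurableSpace.CountablyGenerated.comap _)
  choose S hS hSpi hSuniv hSgen using hpi
  let I : Set ((JointPath n m → ℝ) × Set (JointPath n m)) := ⋃ g ∈ D, ⋃ i, ⋃ j, ⋃ (_ : d i ≤ d j),
    ⋃ G ∈ S i, {(fun w => M.testMartingale a₀ r g (d j) w - M.testMartingale a₀ r g (d i) w, G)}
  have hI : ∀ p, p ∈ I ↔ ∃ g ∈ D, ∃ i j, d i ≤ d j ∧ ∃ G ∈ S i,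
      p = (fun w => M.testMartingale a₀ r g (d j) w - M.testMartingale a₀ r g (d i) w, G) :=
    fun p => by
    simp [I]
  have hSmeas : ∀ i, ∀ G ∈ S i, MeasurableSet[pathFiltration _ (d i)] G := fun i G hG => by
    rw [hSgen i]
    exact MeasurableSpace.measurableSet_generateFrom hG
  refine ⟨I, ?_, ?_, ?_⟩
  · exact hD.biUnion fun g _ => Set.countable_iUnion fun i => Set.countable_iUnion fun j =>
      Set.countable_iUnion fun _ => (hS i).biUnion fun G _ => Set.countable_singleton _
  · intro p hp
    obtain ⟨g, hg, i, j, hij, G, hG, rfl⟩ := (hI p).1 hp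
    exact ⟨(M.measurable_testMartingale r ha₀ (hDt g hg).1 _).sub
      (M.measurable_testMartingale r ha₀ (hDt g hg).1 _), (pathFiltration _).le _ _ (hSmeas i G hG)⟩
  intro y Q hQ
  constructor
  · intro h
    refine ⟨h.start, h.absorbed, fun p hp => ?_⟩
    obtain ⟨g, hg, i, j, hij, G, hG, rfl⟩ := (hI p).1 hp
    exact h.martingale g (hDt g hg).1 (hDt g hg).2 _ _ hij G (hSmeas i G hG)
  rintro ⟨h1, h2, h3⟩
  refine ⟨hQ, h1, h2, fun f hf hfc s t hst G hG => ?_⟩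
  have hint := fun {f : EuclideanSpace ℝ (Fin n) → ℝ} (hf : ContDiff ℝ (⊤ : ℕ∞) f)
    (hfc : HasCompactSupport f) (t : ℝ≥0) => integrable_testMartingale (r := r) Q ha₀ hf hfc t
  have hstep : ∀ i j, d i ≤ d j → ∀ G, MeasurableSet[pathFiltration _ (d i)] G →
      ∫ w in G, (M.testMartingale a₀ r f (d j) w - M.testMartingale a₀ r f (d i) w) ∂Q = 0 := by
    intro i j hij G hG
    have hGm := (pathFiltration _).le _ _ hG
    have hzero : ∀ g ∈ D, ∫ w in G, (M.testMartingale a₀ r g (d j) w -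
        M.testMartingale a₀ r g (d i) w) ∂Q = 0 := fun g hg =>
      setIntegral_eq_zero_of_generateFrom ((pathFiltration _).le (d i))
        ((hint (hDt g hg).1 (hDt g hg).2 _).sub (hint (hDt g hg).1 (hDt g hg).2 _))
        (hSgen i) (hSpi i) (hSuniv i)
        (fun G' hG' => h3 _ ((hI _).2 ⟨g, hg, i, j, hij, G', hG', rfl⟩)) hG
    refine abs_eq_zero.1 (le_antisymm (le_of_forall_pos_le_add fun δ hδ => ?_) (abs_nonneg _))
    -- With tolerance `ε` the test martingales of `f` and `g` differ by at most `ε (1 + d i)` and `ε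
    -- (1 + d j)` at the two times; the chosen `ε` makes the sum `δ`.
    obtain ⟨g, hg, hfg, hfg'⟩ := hDd f hf hfc (max r ‖a₀‖) (δ / (2 + d i + d j)) (by positivity)
    have happ := abs_testMartingale_sub_le ha₀ hf hfc (hDt g hg).1 (hDt g hg).2 hfg hfg' (r := r)
    have hint2 : ∀ {f : EuclideanSpace ℝ (Fin n) → ℝ}, ContDiff ℝ (⊤ : ℕ∞) f →
        HasCompactSupport f → Integrable (fun w => M.testMartingale a₀ r f (d j) w -
          M.testMartingale a₀ r f (d i) w) Q := fun hf hfc => (hint hf hfc _).sub (hint hf hfc _)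
    have heq := integral_sub (μ := Q.restrict G) (hint2 hf hfc).integrableOn
      (hint2 (hDt g hg).1 (hDt g hg).2).integrableOn
    rw [hzero g hg, sub_zero] at heq
    rw [← heq, zero_add]
    have hb := norm_setIntegral_le_of_norm_le_const (μ := Q) (s := G) (C := δ)
      (f := fun w => (M.testMartingale a₀ r f (d j) w - M.testMartingale a₀ r f (d i) w) -
        (M.testMartingale a₀ r g (d j) w - M.testMartingale a₀ r g (d i) w)) (measure_lt_top Q G)
      fun w _ => by
        rw [sub_sub_sub_comm]
        refine (abs_sub _ _).trans ((add_le_add (happ _ w) (happ _ w)).trans_eq ?_)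
        field_simp
        ring
    refine hb.trans ?_
    exact mul_le_of_le_one_right hδ.le measureReal_le_one
  rw [integral_sub (hint hf hfc _).integrableOn (hint hf hfc _).integrableOn, sub_eq_zero]
  -- `G` is known at every dense time after `s`, so the integrals agree at all of these, and
  -- continuity extends the common value to `s` and `t`.
  have key : ∀ i j, s < d i → s < d j → ∫ w in G, M.testMartingale a₀ r f (d j) w ∂Q =
      ∫ w in G, M.testMartingale a₀ r f (d i) w ∂Q := by
    have aux : ∀ i j, s < d i → d i ≤ d j → ∫ w in G, M.testMartingale a₀ r f (d j) w ∂Q =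
        ∫ w in G, M.testMartingale a₀ r f (d i) w ∂Q := fun i j hi hij => by
      have := hstep i j hij G ((pathFiltration _).mono hi.le _ hG)
      rwa [integral_sub (hint hf hfc _).integrableOn (hint hf hfc _).integrableOn,
        sub_eq_zero] at this
    intro i j hi hj
    rcases le_total (d i) (d j) with hij | hij
    · exact aux i j hi hij
    · exact (aux j i hj hij).symm
  have hdense := TopologicalSpace.denseRange_denseSeq ℝ≥0
  obtain ⟨i, hi⟩ := hdense.exists_mem_open (isOpen_Ioi (a := s)) ⟨s + 1, by simp⟩
  have hcl : IsClosed {q | ∫ w in G, M.testMartingale a₀ r f q w ∂Q =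
      ∫ w in G, M.testMartingale a₀ r f (d i) w ∂Q} :=
    isClosed_eq (continuous_setIntegral_testMartingale Q ha₀ hf hfc G) continuous_const
  have hsub : Set.Ici s ⊆ {q | ∫ w in G, M.testMartingale a₀ r f q w ∂Q =
      ∫ w in G, M.testMartingale a₀ r f (d i) w ∂Q} := by
    rw [← closure_Ioi s]
    refine closure_minimal ((hdense.open_subset_closure_inter isOpen_Ioi).trans
      (closure_minimal ?_ hcl)) hcl
    rintro _ ⟨hq, j, rfl⟩
    exact key i j hi hq
  have h4 := hsub (Set.mem_Ici.2 hst)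
  have h5 := hsub (Set.self_mem_Ici (a := s))
  exact Eq.trans h4 (Eq.symm h5)

variable (M) in
/-- The set of the codes of solutions is a Borel set. -/
theorem measurableSet_isSolution {α : Type*} [MeasurableSpace α] (ha₀ : a₀ ∈ M.actions) (r : ℝ)
    (κ : Kernel α (JointPath n m)) [IsMarkovKernel κ] :
    MeasurableSet {p : EuclideanSpace ℝ (Fin n) × α | M.IsSolution a₀ r p.1 (κ p.2)} := by
  obtain ⟨I, hI, hIm, hiff⟩ := M.exists_countable_martingale_conditions ha₀ r
  simp only [fun p : EuclideanSpace ℝ (Fin n) × α => hiff p.1 (κ p.2) inferInstance]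
  have h1 : MeasurableSet {p : EuclideanSpace ℝ (Fin n) × α | ∀ᵐ w ∂κ p.2, (w 0).1 = p.1} := by
    have hs : MeasurableSet {q : (EuclideanSpace ℝ (Fin n) × α) × JointPath n m |
        (q.2 0).1 ≠ q.1.1} :=
      (measurableSet_eq_fun ((measurable_evalPath 0).comp measurable_snd).fst
        measurable_fst.fst).compl
    have := Kernel.measurable_kernel_prodMk_left (κ := κ.comap (Prod.snd :
      EuclideanSpace ℝ (Fin n) × α → α) measurable_snd) hs
    exact this (measurableSet_singleton 0)
  have h2 : MeasurableSet {p : EuclideanSpace ℝ (Fin n) × α |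
      ∀ᵐ w ∂κ p.2, M.IsAbsorbed fun t => (w t).1} :=
    ((κ.measurable_coe M.measurableSet_isAbsorbed.compl).comp measurable_snd)
      (measurableSet_singleton 0)
  refine h1.inter (h2.inter ?_)
  have : {p : EuclideanSpace ℝ (Fin n) × α | ∀ q ∈ I, ∫ w in q.2, q.1 w ∂κ p.2 = 0} =
      ⋂ q ∈ I, {p | ∫ w in q.2, q.1 w ∂κ p.2 = 0} := by
    ext
    simp
  change MeasurableSet {p : EuclideanSpace ℝ (Fin n) × α | ∀ q ∈ I, ∫ w in q.2, q.1 w ∂κ p.2 = 0}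
  rw [this]
  refine .biInter hI fun q hq => ?_
  simp only [← integral_indicator (hIm q hq).2]
  have := (StronglyMeasurable.integral_kernel (κ := κ)
    ((hIm q hq).1.indicator (hIm q hq).2).stronglyMeasurable).measurable
  exact (this.comp measurable_snd) (measurableSet_singleton 0)

end DiffusionModel

/-! ### Optional stopping by discretization. -/

section OptionalStopping

/-- A sum of increments over the part of a partition which lies before `ρ` telescopes. -/
theorem exists_sum_increments_eq {N : ℕ} {p : ℕ → ℝ≥0} (hp : Monotone p) {ρ : ℝ≥0} (h0 : p 0 < ρ)
    (hN : ρ ≤ p N) (x : ℝ≥0 → ℝ) :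
    ∃ j, p j < ρ ∧ ρ ≤ p (j + 1) ∧
      ∑ i ∈ Finset.range N, (if p i < ρ then x (p (i + 1)) - x (p i) else 0) =
        x (p (j + 1)) - x (p 0) := by
  classical
  have hex : ∃ j, ρ ≤ p j := ⟨N, hN⟩
  obtain ⟨j, hj⟩ : ∃ j, Nat.find hex = j + 1 := by
    refine Nat.exists_eq_succ_of_ne_zero fun h => ?_
    have := Nat.find_spec hex
    rw [h] at this
    exact absurd this (not_le.2 h0)
  have hjs : ρ ≤ p (j + 1) := hj ▸ Nat.find_spec hex
  have hjl : ∀ i ≤ j, p i < ρ := fun i hi =>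
    not_le.1 (Nat.find_min hex (by rw [hj]; exact Nat.lt_succ_of_le hi))
  refine ⟨j, hjl j le_rfl, hjs, ?_⟩
  rw [← Finset.sum_filter]
  have hfilter : (Finset.range N).filter (fun i => p i < ρ) = Finset.range (j + 1) := by
    ext i
    rw [Finset.mem_filter, Finset.mem_range, Finset.mem_range]
    constructor
    · rintro ⟨-, hi⟩
      by_contra hij
      exact absurd hi (not_lt.2 (hjs.trans (hp (not_lt.1 hij))))
    · intro hi
      have hpi := hjl i (Nat.lt_succ_iff.1 hi)
      refine ⟨?_, hpi⟩
      by_contra hiN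
      exact absurd hpi (not_lt.2 (hN.trans (hp (not_lt.1 hiN))))
  rw [hfilter, Finset.sum_range_sub (fun i => x (p i))]

/-- Optional stopping for continuous locally bounded martingales at bounded stopping times. -/
theorem setIntegral_stopped_sub_eq_zero {Ω : Type*} {m0 : MeasurableSpace Ω} {μ : Measure Ω}
    [IsFiniteMeasure μ] {ℱ : Filtration ℝ≥0 m0} {T : ℝ≥0 → Ω → ℝ}
    (hT : ∀ t, Measurable (T t)) (hcont : ∀ ω, Continuous fun t => T t ω) {s t : ℝ≥0} (hst : s ≤ t)
    {C : ℝ} (hC : ∀ q ≤ t, ∀ ω, |T q ω| ≤ C)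
    (hmart : ∀ p q, p ≤ q → ∀ G, MeasurableSet[ℱ p] G → ∫ ω in G, (T q ω - T p ω) ∂μ = 0)
    {ρ : Ω → ℝ≥0} (hρt : ∀ ω, ρ ω ≤ t) (hρ : ∀ q, MeasurableSet[ℱ q] {ω | ρ ω ≤ q})
    {G : Set Ω} (hG : MeasurableSet[ℱ s] G) (hGρ : ∀ ω ∈ G, s < ρ ω) :
    ∫ ω in G, (T (ρ ω) ω - T s ω) ∂μ = 0 := by
  -- `p k` divides `[s, t]` into `k + 1` equal steps and stays at `t` afterwards.
  let p : ℕ → ℕ → ℝ≥0 := fun k i => min t (s + (t - s) * (i / (k + 1)))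
  have hp0 : ∀ k, p k 0 = s := fun k => by simp [p, hst]
  have hpN : ∀ k, p k (k + 1) = t := fun k => by
    simp [p, add_tsub_cancel_of_le hst]
  have hpmono : ∀ k, Monotone (p k) := fun k i j hij => by
    refine min_le_min le_rfl (add_le_add le_rfl (mul_le_mul le_rfl ?_ zero_le zero_le))
    gcongr
  have hps : ∀ k i, s ≤ p k i := fun k i => le_min hst le_self_add
  have hpt : ∀ k i, p k i ≤ t := fun k i => min_le_left _ _
  have hpstep : ∀ k i, (p k (i + 1) : ℝ) ≤ p k i + (t - s : ℝ≥0) * (1 / ((k : ℝ) + 1)) := by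
    intro k i
    have : p k (i + 1) ≤ p k i + (t - s) * (1 / ((k : ℝ≥0) + 1)) := by
      simp only [p]
      rw [min_add]
      refine min_le_min le_self_add (le_of_eq ?_)
      push_cast
      ring
    exact_mod_cast this
  -- Whether `p k i < ρ` is known at time `p k i`, so each retained increment has integral zero over
  -- `G`. On `G` the sum telescopes to the increment from `s` to the first grid point at or after
  -- `ρ`.
  let Y : ℕ → Ω → ℝ := fun k ω => ∑ i ∈ Finset.range (k + 1),
    (if p k i < ρ ω then T (p k (i + 1)) ω - T (p k i) ω else 0)
  have hset : ∀ q, MeasurableSet[ℱ q] {ω | q < ρ ω} := fun q => by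
    have := (hρ q).compl
    simpa only [Set.compl_ofPred, not_le] using this
  have hYm : ∀ k, Measurable (Y k) := fun k => Finset.measurable_sum _ fun i _ =>
    Measurable.ite (ℱ.le _ _ (hset _)) ((hT _).sub (hT _)) measurable_const
  have hsub_int : ∀ q ≤ t, ∀ q' ≤ t, Integrable (fun ω => T q ω - T q' ω) μ := fun q hq q' hq' =>
    (Integrable.of_bound (hT q).aestronglyMeasurable C (Eventually.of_forall (hC q hq))).sub
      (Integrable.of_bound (hT q').aestronglyMeasurable C (Eventually.of_forall (hC q' hq')))
  have hY0 : ∀ k, ∫ ω in G, Y k ω ∂μ = 0 := by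
    intro k
    have hind : ∀ i, (fun ω => if p k i < ρ ω then T (p k (i + 1)) ω - T (p k i) ω else 0) =
        {ω | p k i < ρ ω}.indicator fun ω => T (p k (i + 1)) ω - T (p k i) ω := fun i => by
      ext ω
      simp [Set.indicator_apply]
    simp only [Y]
    rw [integral_finsetSum]
    · refine Finset.sum_eq_zero fun i _ => ?_
      rw [hind i, setIntegral_indicator (ℱ.le _ _ (hset _))]
      exact hmart _ _ (hpmono k i.le_succ) _ ((ℱ.mono (hps k i) _ hG).inter (hset _))
    · intro i _
      rw [hind i]
      exact ((hsub_int _ (hpt k _) _ (hpt k _)).indicator (ℱ.le _ _ (hset _))).integrableOn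
  have hYsum : ∀ k, ∀ ω ∈ G, ∃ q, q ≤ t ∧ Y k ω = T q ω - T s ω ∧ ρ ω ≤ q ∧
      (q : ℝ) ≤ ρ ω + (t - s : ℝ≥0) * (1 / ((k : ℝ) + 1)) := by
    intro k ω hω
    obtain ⟨j, h1, h2, h3⟩ := exists_sum_increments_eq (N := k + 1) (hpmono k)
      ((hp0 k).trans_lt (hGρ ω hω)) ((hρt ω).trans_eq (hpN k).symm) fun q => T q ω
    rw [hp0] at h3
    refine ⟨p k (j + 1), hpt k _, h3, h2, (hpstep k j).trans ?_⟩
    gcongr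
  have hlim : Tendsto (fun k => ∫ ω in G, Y k ω ∂μ) atTop
      (𝓝 (∫ ω in G, (T (ρ ω) ω - T s ω) ∂μ)) := by
    refine tendsto_integral_of_dominated_convergence (fun _ => C + C)
      (fun k => (hYm k).aestronglyMeasurable) (integrable_const _) (fun k => ?_) ?_
    · refine (ae_restrict_iff' (ℱ.le _ _ hG)).2 (Eventually.of_forall fun ω hω => ?_)
      obtain ⟨q, hq, hYq, -⟩ := hYsum k ω hω
      rw [hYq]
      exact (abs_sub _ _).trans (add_le_add (hC q hq ω) (hC s hst ω))
    · refine (ae_restrict_iff' (ℱ.le _ _ hG)).2 (Eventually.of_forall fun ω hω => ?_)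
      choose q hq hYq hρq hqρ using fun k => hYsum k ω hω
      simp only [hYq]
      refine Tendsto.sub_const (((hcont ω).tendsto (ρ ω)).comp ?_) _
      rw [← NNReal.tendsto_coe]
      refine tendsto_of_tendsto_of_tendsto_of_le_of_le tendsto_const_nhds ?_
        (fun k => NNReal.coe_le_coe.2 (hρq k)) hqρ
      have := ((tendsto_one_div_add_atTop_nhds_zero_nat (𝕜 := ℝ)).const_mul
        ((t - s : ℝ≥0) : ℝ)).const_add (ρ ω : ℝ)
      simpa using this
  simp only [hY0] at hlim
  exact tendsto_nhds_unique hlim tendsto_const_nhds |>.symm ▸ rfl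

end OptionalStopping

/-! ### Switching to another solution at a stopping time. -/

namespace DiffusionModel

variable {n m : ℕ}

theorem stopPath_concatPath_of_le {s ρ : ℝ≥0} (h : s ≤ ρ) (w v : JointPath n m) :
    stopPath s (concatPath ρ w v) = stopPath s w :=
  ContinuousMap.ext fun q => by
    rw [stopPath_apply, stopPath_apply, concatPath_apply_of_le ((min_le_right _ _).trans h)]

theorem stopPath_concatPath_stopPath {s ρ : ℝ≥0} (w v : JointPath n m) :
    stopPath s (concatPath ρ w (stopPath (s - ρ) v)) = stopPath s (concatPath ρ w v) :=
  ContinuousMap.ext fun q => by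
    simp only [stopPath_apply, concatPath, ContinuousMap.coe_mk, zero_min]
    rw [min_eq_left (tsub_le_tsub_right (min_le_right q s) ρ)]

theorem mem_iff_of_stopPath_eq {s : ℝ≥0} {G : Set (JointPath n m)}
    (hG : MeasurableSet[pathFiltration _ s] G) {w v : JointPath n m}
    (h : stopPath s w = stopPath s v) : w ∈ G ↔ v ∈ G := by
  have := (measurableSet_pathFiltration_iff.1 hG).2
  rw [← this w, h, this v]

open Classical in
/-- The path that switches from `w` to the increments of `v` at the time `τ w` if `w ∈ H`. -/
noncomputable def switchPath (H : Set (JointPath n m)) (τ : JointPath n m → ℝ≥0)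
    (p : JointPath n m × JointPath n m) : JointPath n m :=
  if p.1 ∈ H then concatPath (τ p.1) p.1 p.2 else p.1

variable {H : Set (JointPath n m)} {τ : JointPath n m → ℝ≥0}

theorem measurable_switchPath (hH : MeasurableSet H) (hτ : Measurable τ) :
    Measurable (switchPath H τ) := by
  refine Measurable.ite (measurable_fst hH) (measurable_path_of_eval fun t => ?_) measurable_fst
  have hτ' : Measurable fun p : JointPath n m × JointPath n m => τ p.1 := hτ.comp measurable_fst
  exact (measurable_fst.evalPath (measurable_const.min hτ')).add
    ((measurable_snd.evalPath (measurable_const.sub hτ')).sub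
      ((measurable_evalPath 0).comp measurable_snd))

theorem switchPath_zero (p : JointPath n m × JointPath n m) : switchPath H τ p 0 = p.1 0 := by
  unfold switchPath
  split_ifs
  · exact concatPath_apply_of_le zero_le _ _
  · rfl

variable {M : DiffusionModel n m} {a₀ : EuclideanSpace ℝ (Fin m)} {r : ℝ}
  {x : EuclideanSpace ℝ (Fin n)}

theorem concatPath_fst_of_ge {t ρ : ℝ≥0} (h : ρ ≤ t) {w v : JointPath n m}
    (hv : (v 0).1 = (w ρ).1) : (concatPath ρ w v t).1 = (v (t - ρ)).1 := by
  rw [concatPath_apply_of_ge h, Prod.fst_add, Prod.fst_sub, hv, add_sub_cancel]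

theorem IsAbsorbed.concatPath {ρ : ℝ≥0} {w v : JointPath n m}
    (hw : M.IsAbsorbed fun t => (w t).1) (hv : M.IsAbsorbed fun t => (v t).1)
    (hvw : (v 0).1 = (w ρ).1) : M.IsAbsorbed fun t => (concatPath ρ w v t).1 := by
  intro s t hst hs
  simp only at hs ⊢
  rcases le_total t ρ with htρ | htρ
  · rw [concatPath_apply_of_le (hst.trans htρ)] at hs ⊢
    rw [concatPath_apply_of_le htρ]
    exact hw s t hst hs
  rw [concatPath_fst_of_ge htρ hvw]
  rcases le_total s ρ with hsρ | hsρ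
  · rw [concatPath_apply_of_le hsρ] at hs ⊢
    have h1 : (w ρ).1 = (w s).1 := hw s ρ hsρ hs
    have h2 := hv 0 (t - ρ) zero_le (by simp only; rwa [hvw, h1])
    simp only at h2
    rw [h2, hvw, h1]
  · rw [concatPath_fst_of_ge hsρ hvw] at hs ⊢
    exact hv (s - ρ) (t - ρ) (tsub_le_tsub_right hst ρ) hs

/-- Switching, at a stopping time, to a solution started at the present state gives a solution. -/
theorem IsSolution.map_switchPath {P : Measure (JointPath n m)} (hP : M.IsSolution a₀ r x P)
    (ha₀ : a₀ ∈ M.actions) (hH : MeasurableSet H) (hτ : Measurable τ)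
    (hHτ : ∀ s, MeasurableSet[pathFiltration _ s] (H ∩ {w | τ w ≤ s}))
    (κ : Kernel (JointPath n m) (JointPath n m)) [IsMarkovKernel κ]
    (hκ : ∀ w ∈ H, M.IsSolution a₀ r (w (τ w)).1 (κ w)) :
    M.IsSolution a₀ r x ((P ⊗ₘ κ).map (switchPath H τ)) := by
  have := hP.isProbabilityMeasure
  have hm := measurable_switchPath hH hτ
  refine ⟨Measure.isProbabilityMeasure_map hm.aemeasurable, ?_, ?_, fun f hf hfc s t hst G hG => ?_⟩
  · have hset : MeasurableSet {w : JointPath n m | (w 0).1 = x} :=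
      (measurable_evalPath 0).fst (measurableSet_singleton x)
    refine (ae_map_iff hm.aemeasurable hset).2 (Measure.ae_compProd_of_ae_ae (hm hset) ?_)
    filter_upwards [hP.start] with w hw
    exact Eventually.of_forall fun v => by rw [switchPath_zero]; exact hw
  · refine (ae_map_iff hm.aemeasurable M.measurableSet_isAbsorbed).2
      (Measure.ae_compProd_of_ae_ae (hm M.measurableSet_isAbsorbed) ?_)
    filter_upwards [hP.absorbed] with w hw
    by_cases hwH : w ∈ H
    · filter_upwards [(hκ w hwH).absorbed, (hκ w hwH).start] with v hv hv0
      rw [switchPath, if_pos hwH]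
      exact hw.concatPath hv hv0
    · exact Eventually.of_forall fun v => by rw [switchPath, if_neg hwH]; exact hw
  obtain rfl | hst := hst.eq_or_lt
  · simp
  have hGm := (pathFiltration _).le _ _ hG
  obtain ⟨C, hC⟩ := M.exists_testMartingale_bound r ha₀ hf hfc t
  have hTm : Measurable fun w => M.testMartingale a₀ r f t w - M.testMartingale a₀ r f s w :=
    (M.measurable_testMartingale r ha₀ hf t).sub (M.measurable_testMartingale r ha₀ hf s)
  rw [← integral_indicator hGm, integral_map hm.aemeasurable
    (hTm.indicator hGm).aestronglyMeasurable]
  rw [Measure.integral_compProd]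
  swap
  · refine Integrable.of_bound ((hTm.indicator hGm).comp hm).aestronglyMeasurable (C + C)
      (Eventually.of_forall fun p => ?_)
    refine (norm_indicator_le_norm_self _ _).trans ?_
    exact (abs_sub _ _).trans (add_le_add (hC t le_rfl _) (hC s hst.le _))
  classical
  -- Up to time `t`, the path follows the `P`-sample until `ρ`. By optional stopping, the increment
  -- from `s` to `ρ` has integral zero over `G ∩ {s < ρ}`; it remains to see, for each `w`, that
  -- averaging over `κ w` leaves exactly that increment.
  set ρ : JointPath n m → ℝ≥0 := fun w => if w ∈ H then min t (τ w) else t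
  have hρH : ∀ w ∈ H, ρ w = min t (τ w) := fun w hw => if_pos hw
  have hρH' : ∀ w ∉ H, ρ w = t := fun w hw => if_neg hw
  have hρt : ∀ w, ρ w ≤ t := fun w => by
    by_cases hw : w ∈ H
    · exact (hρH w hw).trans_le (min_le_left _ _)
    · exact (hρH' w hw).le
  have hρ : ∀ q, MeasurableSet[pathFiltration _ q] {w | ρ w ≤ q} := fun q => by
    rcases le_or_gt t q with hq | hq
    · have : {w | ρ w ≤ q} = Set.univ := Set.eq_univ_of_forall fun w => (hρt w).trans hq
      rw [this]
      exact MeasurableSet.univ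
    · have : {w | ρ w ≤ q} = H ∩ {w | τ w ≤ q} := by
        ext w
        by_cases hw : w ∈ H
        · simp [hρH w hw, hw, hq.not_ge]
        · simp [hρH' w hw, hw, hq]
      rw [this]
      exact hHτ q
  have hsρ : MeasurableSet[pathFiltration _ s] {w | s < ρ w} := by
    have := (hρ s).compl
    simpa only [Set.compl_ofPred, not_le] using this
  have hmain := setIntegral_stopped_sub_eq_zero (μ := P) (ℱ := pathFiltration _)
    (T := M.testMartingale a₀ r f) (G := G ∩ {w | s < ρ w})
    (fun q => M.measurable_testMartingale r ha₀ hf q)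
    (fun w => M.continuous_testMartingale r ha₀ hf hfc w) hst.le hC (hP.martingale f hf hfc)
    hρt hρ (hG.inter hsρ) fun w hw => hw.2
  rw [← integral_indicator (hGm.inter ((pathFiltration _).le _ _ hsρ))] at hmain
  rw [← hmain]
  refine integral_congr_ae (Eventually.of_forall fun w => ?_)
  simp only
  by_cases hwH : w ∈ H
  swap
  · simp only [switchPath, if_neg hwH, integral_const, probReal_univ, one_smul]
    have : w ∈ G ∩ {w | s < ρ w} ↔ w ∈ G := by simp [hρH' w hwH, hst]
    simp only [Set.indicator_apply, this, hρH' w hwH]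
  have hκw := hκ w hwH
  simp only [switchPath, if_pos hwH]
  have hstart := hκw.start
  set q := τ w
  rcases le_or_gt t q with htq | htq
  · have hρw : ρ w = t := by rw [hρH w hwH, min_eq_left htq]
    have hmem : w ∈ G ∩ {w | s < ρ w} ↔ w ∈ G := by simp [hρw, hst]
    simp only [Set.indicator_apply, hmem, hρw, M.testMartingale_concatPath_of_le r htq,
      M.testMartingale_concatPath_of_le r (hst.le.trans htq),
      mem_iff_of_stopPath_eq hG (stopPath_concatPath_of_le (hst.le.trans htq) w _),
      integral_const, probReal_univ, one_smul]
  have hρw : ρ w = q := by rw [hρH w hwH, min_eq_right htq.le]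
  rcases lt_or_ge s q with hsq | hsq
  · have hmem : w ∈ G ∩ {w | s < ρ w} ↔ w ∈ G := by simp [hρw, hsq]
    simp only [Set.indicator_apply, hmem, hρw,
      mem_iff_of_stopPath_eq hG (stopPath_concatPath_of_le hsq.le w _)]
    split_ifs
    swap
    · simp
    -- When the switch comes after `s`, `w` alone decides `G`, so the increment after the switch
    -- only has to vanish in mean over the whole space.
    have h0 := hκw.martingale f hf hfc 0 (t - q) zero_le Set.univ MeasurableSet.univ
    rw [setIntegral_univ] at h0
    have heq : ∫ v, (M.testMartingale a₀ r f t (concatPath q w v) -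
        M.testMartingale a₀ r f s (concatPath q w v)) ∂κ w =
        ∫ v, ((M.testMartingale a₀ r f q w - M.testMartingale a₀ r f s w) +
          (M.testMartingale a₀ r f (t - q) v - M.testMartingale a₀ r f 0 v)) ∂κ w := by
      refine integral_congr_ae ?_
      filter_upwards [hstart] with v hv
      rw [M.testMartingale_concatPath_of_ge r ha₀ hf hfc htq.le hv,
        M.testMartingale_concatPath_of_le r hsq.le]
      ring
    have hint : Integrable (fun v => M.testMartingale a₀ r f (t - q) v -
        M.testMartingale a₀ r f 0 v) (κ w) :=
      (integrable_testMartingale _ ha₀ hf hfc _).sub (integrable_testMartingale _ ha₀ hf hfc _)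
    rw [heq, integral_add (integrable_const _) hint, h0]
    simp
  · have hmem : w ∉ G ∩ {w | s < ρ w} := by simp [hρw, hsq]
    rw [Set.indicator_of_notMem hmem]
    have hcm : Measurable fun v : JointPath n m => concatPath q w v :=
      measurable_path_of_eval fun t => measurable_const.add
        ((measurable_evalPath _).sub (measurable_evalPath _))
    -- When the switch comes no later than `s`, fixing `w` turns `G` into an event about `v` known
    -- at time `s - q`.
    have hGq : MeasurableSet[pathFiltration _ (s - q)] {v | concatPath q w v ∈ G} :=
      measurableSet_pathFiltration_iff.2 ⟨hcm hGm, fun v =>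
        mem_iff_of_stopPath_eq hG (stopPath_concatPath_stopPath w v)⟩
    have h0 := hκw.martingale f hf hfc (s - q) (t - q) (tsub_le_tsub_right hst.le q) _ hGq
    rw [← integral_indicator ((pathFiltration _).le _ _ hGq)] at h0
    rw [← h0]
    refine integral_congr_ae ?_
    filter_upwards [hstart] with v hv
    simp only [Set.indicator_apply, Set.mem_ofPred_eq]
    split_ifs
    · rw [M.testMartingale_concatPath_of_ge r ha₀ hf hfc htq.le hv,
        M.testMartingale_concatPath_of_ge r ha₀ hf hfc hsq hv]
      ring
    · rfl

/-- If, with positive probability, one switches to a solution which avoids `B` with positive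
probability, then `B` is avoided with positive probability. -/
theorem IsSolution.not_ae_map_switchPath {P : Measure (JointPath n m)}
    (hP : M.IsSolution a₀ r x P) (hH : MeasurableSet H) (hτ : Measurable τ) (hPH : P H ≠ 0)
    (κ : Kernel (JointPath n m) (JointPath n m)) [IsMarkovKernel κ]
    {B : Set (EuclideanSpace ℝ (Fin n))} (hBM : B ⊆ M.terminal)
    (hκ : ∀ w ∈ H, M.IsSolution a₀ r (w (τ w)).1 (κ w)) (hHB : ∀ w ∈ H, (w (τ w)).1 ∉ B)
    (hκB : ∀ w ∈ H, ¬ ∀ᵐ v ∂κ w, ∃ k : ℕ, (v k).1 ∈ B) :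
    ¬ ∀ᵐ w ∂(P ⊗ₘ κ).map (switchPath H τ), ∃ k : ℕ, (w k).1 ∈ B := by
  intro h
  have := hP.isProbabilityMeasure
  have h1 := Measure.ae_ae_of_ae_compProd
    (ae_of_ae_map (measurable_switchPath hH hτ).aemeasurable h)
  refine hPH (measure_eq_zero_iff_ae_notMem.2 ?_)
  filter_upwards [h1, hP.absorbed] with w hw hwabs hwH
  refine hκB w hwH ?_
  filter_upwards [hw, (hκ w hwH).start, (hκ w hwH).absorbed] with v ⟨k, hk⟩ hv0 hvabs
  rw [switchPath, if_pos hwH] at hk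
  rcases le_total (k : ℝ≥0) (τ w) with hkτ | hkτ
  -- Had `w` reached `B` before the switch, absorption would keep it in `B` at the switching time.
  · rw [concatPath_apply_of_le hkτ] at hk
    have h2 : (w (τ w)).1 = (w k).1 := hwabs k (τ w) hkτ (hBM hk)
    exact absurd (h2 ▸ hk) (hHB w hwH)
  · rw [concatPath_fst_of_ge hkτ hv0] at hk
    have h2 : (v k).1 = (v (k - τ w)).1 := hvabs _ k tsub_le_self (hBM hk)
    exact ⟨k, by rwa [h2]⟩

end DiffusionModel

/-! ### Grit, avoidable states and the contradiction by switching. -/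

namespace DiffusionModel

variable {n m : ℕ} {M : DiffusionModel n m} {B : Set (EuclideanSpace ℝ (Fin n))}
  {x : EuclideanSpace ℝ (Fin n)}

namespace ControlledDiffusion

theorem ae_occurs_iff (S : M.ControlledDiffusion x) (hBM : B ⊆ M.terminal) :
    ∀ᵐ ω ∂S.P, (M.Occurs B fun t => S.X t ω) ↔ ∃ k : ℕ, S.X k ω ∈ B := by
  filter_upwards [S.absorbed] with ω hω
  exact IsAbsorbed.occurs_iff (M := M) hω (S.continuous_X ω) hBM

/-- Absorption turns an event over uncountably many times into one over integer times, up to a null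
set. -/
theorem nullMeasurableSet_occurs (S : M.ControlledDiffusion x) (hB : MeasurableSet B)
    (hBM : B ⊆ M.terminal) : NullMeasurableSet {ω | M.Occurs B fun t => S.X t ω} S.P := by
  have h : MeasurableSet {ω | ∃ k : ℕ, S.X k ω ∈ B} := by
    simp only [Set.ofPred_exists]
    exact .iUnion fun k => (S.adapted_X.stronglyMeasurable (i := (k : ℝ≥0))).measurable hB
  refine h.nullMeasurableSet.congr ?_
  filter_upwards [S.ae_occurs_iff hBM] with ω hω
  exact propext hω.symm

theorem real_occurs_eq_one_iff (S : M.ControlledDiffusion x) (hB : MeasurableSet B)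
    (hBM : B ⊆ M.terminal) :
    S.P.real {ω | M.Occurs B fun t => S.X t ω} = 1 ↔
      ∀ᵐ ω ∂S.P, M.Occurs B fun t => S.X t ω := by
  rw [Measure.real, ENNReal.toReal_eq_one_iff,
    ← mem_ae_iff_prob_eq_one₀ (S.nullMeasurableSet_occurs hB hBM)]
  rfl

theorem nonempty_actions (S : M.ControlledDiffusion x) : M.actions.Nonempty := by
  obtain ⟨ω⟩ := S.P.nonempty_of_neZero
  exact ⟨_, S.u_mem 0 ω⟩

end ControlledDiffusion

/-- The grit is one if and only if the event occurs almost surely under all courses of actions. -/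
theorem grit_eq_one_iff (hx : Nonempty (M.ControlledDiffusion x)) (hB : MeasurableSet B)
    (hBM : B ⊆ M.terminal) :
    M.grit B x = 1 ↔
      ∀ S : M.ControlledDiffusion x, ∀ᵐ ω ∂S.P, M.Occurs B fun t => S.X t ω := by
  have hbdd : BddBelow (Set.range fun S : M.ControlledDiffusion x =>
      S.P.real {ω | M.Occurs B fun t => S.X t ω}) :=
    ⟨0, by rintro _ ⟨S, rfl⟩; exact measureReal_nonneg⟩
  rw [forall_congr' fun S => (S.real_occurs_eq_one_iff hB hBM).symm]
  constructor
  · intro h S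
    refine le_antisymm measureReal_le_one ?_
    rw [← h]
    exact ciInf_le hbdd S
  · intro h
    unfold grit
    -- Nonemptiness enters here: over an empty family the real infimum would be `0`.
    simp only [h, ciInf_const]

section HittingTime

variable {E A : Type*} [NormedAddCommGroup E] [NormedAddCommGroup A]

open Classical in
/-- The first time at which the first component of a path is in `K`, if this time is at most `N`. -/
noncomputable def firstHit (K : Set E) (N : ℝ≥0) (w : C(ℝ≥0, E × A)) : ℝ≥0 :=
  if w ∈ hitBy (Prod.fst ⁻¹' K) N then sInf {s | (w s).1 ∈ K} else 0

variable {K : Set E} {N : ℝ≥0}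

theorem firstHit_mem (hK : IsClosed K) {w : C(ℝ≥0, E × A)}
    (hw : w ∈ hitBy (Prod.fst ⁻¹' K) N) : (w (firstHit K N w)).1 ∈ K := by
  rw [firstHit, if_pos hw]
  obtain ⟨s, -, hs⟩ := hw
  exact (hK.preimage w.continuous.fst).csInf_mem ⟨s, hs⟩ (OrderBot.bddBelow _)

theorem firstHit_le {w : C(ℝ≥0, E × A)} {q : ℝ≥0} (hq : (w q).1 ∈ K) : firstHit K N w ≤ q := by
  unfold firstHit
  split_ifs
  · exact csInf_le' (show q ∈ {s | (w s).1 ∈ K} from hq)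
  · exact zero_le

/-- Closedness of `K` makes the infimum of hitting times attained. The identity is what makes
`firstHit` a stopping time on the paths that hit `K` by time `N`. -/
theorem hitBy_inter_firstHit_le (hK : IsClosed K) (s : ℝ≥0) :
    hitBy (Prod.fst ⁻¹' K) N ∩ {w : C(ℝ≥0, E × A) | firstHit K N w ≤ s} =
      hitBy (Prod.fst ⁻¹' K) (min s N) := by
  ext w
  constructor
  · rintro ⟨hw, hs⟩
    refine ⟨firstHit K N w, le_min hs ?_, firstHit_mem hK hw⟩
    obtain ⟨q, hq, hqK⟩ := hw
    exact (firstHit_le hqK).trans hq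
  · rintro ⟨q, hq, hqK⟩
    exact ⟨⟨q, hq.trans (min_le_right _ _), hqK⟩,
      (firstHit_le hqK).trans (hq.trans (min_le_left _ _))⟩

variable [MeasurableSpace E] [BorelSpace E] [MeasurableSpace A] [BorelSpace A]
  [SecondCountableTopology E]

theorem measurableSet_hitBy_inter_firstHit_le (hK : IsClosed K) (s : ℝ≥0) :
    MeasurableSet[pathFiltration (E × A) s]
      (hitBy (Prod.fst ⁻¹' K) N ∩ {w | firstHit K N w ≤ s}) := by
  rw [hitBy_inter_firstHit_le hK]
  exact (pathFiltration _).mono (min_le_left _ _) _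
    (measurableSet_hitBy_pathFiltration (hK.preimage continuous_fst) _)

theorem measurable_firstHit (hK : IsClosed K) :
    Measurable (firstHit K N : C(ℝ≥0, E × A) → ℝ≥0) := by
  refine measurable_of_Iic fun s => ?_
  have hH := measurableSet_hitBy (hK.preimage (continuous_fst (X := E) (Y := A))) N
  have : firstHit K N ⁻¹' Set.Iic s = (hitBy (Prod.fst ⁻¹' K) N)ᶜ ∪
      (hitBy (Prod.fst ⁻¹' K) N ∩ {w : C(ℝ≥0, E × A) | firstHit K N w ≤ s}) := by
    ext w
    by_cases hw : w ∈ hitBy (Prod.fst ⁻¹' K) N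
    · simp [hw]
    · simp [hw, firstHit]
  rw [this]
  exact hH.compl.union ((pathFiltration _).le _ _ (measurableSet_hitBy_inter_firstHit_le hK s))

end HittingTime

variable {a₀ : EuclideanSpace ℝ (Fin m)}

/-- The states outside `B` from which some solution avoids `B` with positive probability. -/
def avoidable (M : DiffusionModel n m) (a₀ : EuclideanSpace ℝ (Fin m)) (r : ℝ)
    (B : Set (EuclideanSpace ℝ (Fin n))) : Set (EuclideanSpace ℝ (Fin n)) :=
  {y | y ∉ B ∧ ∃ Q, M.IsSolution a₀ r y Q ∧ ¬ ∀ᵐ w ∂Q, ∃ k : ℕ, (w k).1 ∈ B}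

/-- If the distribution of a solution gives positive outer probability to visiting avoidable states,
then there is a solution with the same initial state which avoids `B` with positive probability. -/
theorem IsSolution.exists_not_ae_of_hitBy_avoidable {r : ℝ} {P : Measure (JointPath n m)}
    (hP : M.IsSolution a₀ r x P) (ha₀ : a₀ ∈ M.actions) (hB : MeasurableSet B)
    (hBM : B ⊆ M.terminal) {N : ℝ≥0} (h : P (hitBy (Prod.fst ⁻¹' M.avoidable a₀ r B) N) ≠ 0) :
    ∃ Q, M.IsSolution a₀ r x Q ∧ ¬ ∀ᵐ w ∂Q, ∃ k : ℕ, (w k).1 ∈ B := by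
  have := hP.isProbabilityMeasure
  obtain ⟨κ, hκ, hκs⟩ := exists_kernel_attaining_probabilityMeasures (JointPath n m)
  have hhit : MeasurableSet {w : JointPath n m | ∃ k : ℕ, (w k).1 ∈ B} := by
    simp only [Set.ofPred_exists]
    exact .iUnion fun k => (measurable_evalPath _).fst hB
  -- `V` pairs states outside `B` with codes of solutions from them that avoid `B` with positive
  -- probability. It is Borel, so its projection, the set of avoidable states, is analytic.
  let V : Set (EuclideanSpace ℝ (Fin n) × (ℚ → ℝ)) := {p | M.IsSolution a₀ r p.1 (κ p.2)} ∩
    ((Prod.fst ⁻¹' B)ᶜ ∩ {p | κ p.2 {w : JointPath n m | ∃ k : ℕ, (w k).1 ∈ B}ᶜ = 0}ᶜ)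
  have hV : MeasurableSet V := (M.measurableSet_isSolution ha₀ r κ).inter
    ((measurable_fst hB).compl.inter (((κ.measurable_coe hhit.compl).comp measurable_snd)
      (measurableSet_singleton 0)).compl)
  have hVimage : M.avoidable a₀ r B = Prod.fst '' V := by
    ext y
    constructor
    · rintro ⟨hy, Q, hQ, hQB⟩
      obtain ⟨c, rfl⟩ := hκs Q hQ.isProbabilityMeasure
      exact ⟨(y, c), ⟨hQ, hy, hQB⟩, rfl⟩
    · rintro ⟨p, ⟨hp, hy, hpB⟩, rfl⟩
      exact ⟨hy, _, hp, hpB⟩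
  have hVan := hV.analyticSet
  rw [AnalyticSet] at hVan
  rcases hVan with hempty | ⟨g, hg, hgV⟩
  · refine absurd ?_ h
    rw [hVimage, hempty]
    simp [hitBy]
  have hrange : M.avoidable a₀ r B = Set.range (Prod.fst ∘ g) := by
    rw [hVimage, ← hgV, Set.range_comp]
  rw [hrange] at h
  have hg1 : Continuous (Prod.fst ∘ g) := continuous_fst.comp hg
  obtain ⟨a, ha⟩ := exists_box_hitBy_ne_zero P hg1 N h
  set L : Set (ℕ → ℕ) := {z | ∀ i, z i ≤ a i}
  have hL : IsCompact L := isCompact_box a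
  set K := (Prod.fst ∘ g) '' L
  have hK : IsClosed K := (hL.image hg1).isClosed
  -- Since `g` has range `V`, the second component of `g (σ y)` is, for `y ∈ K`, the code of an
  -- avoiding solution from `y`.
  obtain ⟨σ, hσ, hσK⟩ := exists_measurable_section hL hg1
  have hτ : Measurable (firstHit K N : JointPath n m → ℝ≥0) := measurable_firstHit hK
  let η : Kernel (JointPath n m) (JointPath n m) :=
    κ.comap (fun w => (g (σ (w (firstHit K N w)).1)).2)
      ((hg.measurable.comp (hσ.comp (measurable_id.evalPath hτ).fst)).snd)
  have hη : ∀ w ∈ hitBy (Prod.fst ⁻¹' K) N, M.IsSolution a₀ r (w (firstHit K N w)).1 (η w) ∧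
      (w (firstHit K N w)).1 ∉ B ∧ ¬ ∀ᵐ v ∂η w, ∃ k : ℕ, (v k).1 ∈ B := by
    intro w hw
    have h1 := (hσK _ (firstHit_mem hK hw)).2
    have h2 : g (σ (w (firstHit K N w)).1) ∈ V := hgV ▸ Set.mem_range_self _
    obtain ⟨h3, h4, h5⟩ := h2
    simp only [Function.comp_apply] at h1
    rw [Set.mem_ofPred_eq, h1] at h3
    rw [Set.mem_compl_iff, Set.mem_preimage, h1] at h4
    exact ⟨h3, h4, h5⟩
  have hH : MeasurableSet (hitBy (Prod.fst ⁻¹' K) N : Set (JointPath n m)) :=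
    measurableSet_hitBy (hK.preimage continuous_fst) N
  exact ⟨_, hP.map_switchPath ha₀ hH hτ (measurableSet_hitBy_inter_firstHit_le hK) η
    fun w hw => (hη w hw).1, hP.not_ae_map_switchPath hH hτ ha η hBM (fun w hw => (hη w hw).1)
    (fun w hw => (hη w hw).2.1) fun w hw => (hη w hw).2.2⟩

theorem IsSolution.exists_controlledDiffusion {r : ℝ} {Q : Measure (JointPath n m)}
    (hQ : M.IsSolution a₀ r x Q) (ha₀ : a₀ ∈ M.actions) (hBM : B ⊆ M.terminal)
    (hQB : ¬ ∀ᵐ w ∂Q, ∃ k : ℕ, (w k).1 ∈ B) :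
    ∃ S : M.ControlledDiffusion x, ¬ ∀ᵐ ω ∂S.P, M.Occurs B fun t => S.X t ω := by
  refine ⟨hQ.toControlledDiffusion ha₀, fun h => hQB ?_⟩
  have h1 := (hQ.toControlledDiffusion ha₀).ae_occurs_iff hBM
  filter_upwards [h, h1] with w hw hw1
  exact hw1.1 hw

theorem ControlledDiffusion.isSolution_avoiding (S : M.ControlledDiffusion x)
    (ha₀ : a₀ ∈ M.actions) (hBM : B ⊆ M.terminal)
    (hS : ¬ ∀ᵐ ω ∂S.P, M.Occurs B fun t => S.X t ω) :
    ∃ C : ℝ, ∀ r, C ≤ r → ∃ Q, M.IsSolution a₀ r x Q ∧ ¬ ∀ᵐ w ∂Q, ∃ k : ℕ, (w k).1 ∈ B := by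
  obtain ⟨C, hC⟩ := S.u_bounded
  refine ⟨C, fun r hr => ⟨_, S.isSolution_map_path ha₀ hC hr, fun h => hS ?_⟩⟩
  filter_upwards [ae_of_ae_map S.measurable_path.aemeasurable h, S.ae_occurs_iff hBM] with ω hω hω1
  exact hω1.2 hω

/-- If the grit is one at the initial state, then almost surely a controlled diffusion never visits
a state outside `B` at which the grit is less than one. -/
theorem ControlledDiffusion.ae_forall_grit_eq_one (hM : ∀ y, Nonempty (M.ControlledDiffusion y))
    (hB : MeasurableSet B) (hBM : B ⊆ M.terminal) (hx : M.grit B x = 1)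
    (S : M.ControlledDiffusion x) :
    ∀ᵐ ω ∂S.P, ∀ t, S.X t ω ∉ B → M.grit B (S.X t ω) = 1 := by
  obtain ⟨a₀, ha₀⟩ := S.nonempty_actions
  obtain ⟨C, hC⟩ := S.u_bounded
  -- Integer bounds on the actions and on time leave only countably many null sets to discard.
  have hnull : ∀ r N : ℕ, C ≤ r →
      ∀ᵐ ω ∂S.P, S.path ω ∉ hitBy (Prod.fst ⁻¹' M.avoidable a₀ r B) (N : ℝ≥0) := by
    intro r N hr
    by_contra hpos
    have hne : S.P.map S.path (hitBy (Prod.fst ⁻¹' M.avoidable a₀ r B) (N : ℝ≥0)) ≠ 0 := by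
      intro h0
      refine hpos (measure_eq_zero_iff_ae_notMem.1 (le_antisymm ?_ zero_le))
      -- The hitting set of an analytic set need not be measurable; this inequality holds for
      -- arbitrary sets.
      exact (Measure.le_map_apply S.measurable_path.aemeasurable _).trans h0.le
    obtain ⟨Q, hQ, hQB⟩ := (S.isSolution_map_path ha₀ hC hr).exists_not_ae_of_hitBy_avoidable
      ha₀ hB hBM hne
    obtain ⟨S', hS'⟩ := hQ.exists_controlledDiffusion ha₀ hBM hQB
    exact hS' ((grit_eq_one_iff (hM x) hB hBM).1 hx S')
  have hall : ∀ᵐ ω ∂S.P, ∀ r N : ℕ, C ≤ r →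
      S.path ω ∉ hitBy (Prod.fst ⁻¹' M.avoidable a₀ r B) (N : ℝ≥0) := by
    simpa only [ae_all_iff, Filter.eventually_imp_distrib_left] using hnull
  filter_upwards [hall] with ω hω t ht
  rw [grit_eq_one_iff (hM _) hB hBM]
  by_contra hcon
  obtain ⟨S', hS'⟩ := not_forall.1 hcon
  obtain ⟨C', hC'⟩ := S'.isSolution_avoiding ha₀ hBM hS'
  -- One bound must serve both the actions of `S` and those of the avoiding process `S'`, since the
  -- pasted solution uses both.
  obtain ⟨r, hr⟩ := exists_nat_ge (max C C')
  obtain ⟨N, hN⟩ := exists_nat_ge t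
  exact hω r N ((le_max_left _ _).trans hr) ⟨t, hN, ht, hC' r ((le_max_right _ _).trans hr)⟩

end DiffusionModel

theorem proposition1 {n m : ℕ} (M : DiffusionModel n m)
    (hM : ∀ y, Nonempty (M.ControlledDiffusion y))
    (B : Set (EuclideanSpace ℝ (Fin n))) (hB : MeasurableSet B) (hBM : B ⊆ M.terminal)
    (x : EuclideanSpace ℝ (Fin n)) :
    (M.grit B x = 1 →
      ∀ S : M.ControlledDiffusion x, ∀ᵐ ω ∂S.P, ∀ t : ℝ≥0,
        ¬ M.OccursBy B (fun s => S.X s ω) t → M.grit B (S.X t ω) = 1) ∧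
    (M.grit B x = 1 ↔
      ∀ S : M.ControlledDiffusion x, ∀ᵐ ω ∂S.P, M.Occurs B fun t => S.X t ω) := by
  refine ⟨fun hx S => ?_, DiffusionModel.grit_eq_one_iff (hM x) hB hBM⟩
  filter_upwards [S.ae_forall_grit_eq_one hM hB hBM hx, S.absorbed] with ω hω habs t ht
  -- By absorption, being in `B` at time `t` means that the event has occurred by then.
  exact hω t fun hmem => ht <|
    DiffusionModel.IsAbsorbed.occursBy (M := M) habs (S.continuous_X ω) hBM hmem
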